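/- Conventions. A domain is a nonempty connected open subset of $\mathbb R^n$, $n\ge 1$; $d(x)=\operatorname{dist}(x,\partial\Omega)$ and $B_{x,\tau}=B(x,\tau d(x))$. A bounded domain $\Omega$ is a John domain if there are $\lambda>1$ and $x_0\in\Omega$ such that every $y\in\Omega$ can be joined to $x_0$ by a rectifiable curve $\gamma:[0,\ell]\to\Omega$ parametrized by arc length, $\gamma(0)=y$, $\gamma(\ell)=x_0$, with $\lambda\, d(\gamma(t))\ge t$ for all $t\in[0,\ell]$. A Whitney decomposition of $\Omega$ is a family $\{Q_t\}_{t\in\Gamma}$ of closed dyadic cubes with pairwise disjoint interiors such that $\Omega=\bigcup_t Q_t$, $\operatorname{diam}Q_t\le \operatorname{dist}(Q_t,\partial\Omega)\le 4\operatorname{diam}Q_t$, and $\frac14\operatorname{diam}Q_s\le\operatorname{diam}Q_t\le4\operatorname{diam}Q_s$ whenever $Q_s\cap Q_t\ne\emptyset$. An open covering $\{U_t\}_{t\in\Gamma}$ of $\Omega$, $\bigcup_tU_t=\Omega$, is a tree-covering if $\Gamma$ is the vertex set of a tree with root $a$; $1\le\sum_t\chi_{U_t}\le C_1$ a.e. in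 $\Omega$ for some constant $C_1$; and there are pairwise disjoint open sets $B_t$, $t\ne a$, with $B_t\subseteq U_t\cap U_{t_p}$ ($t_p$ the parent of $t$) and $|U_t|\le C_2|B_t|$ for some constant $C_2$ independent of $t$. We write $s\succeq t$ if the path from $s$ to the root passes through $t$, and $W_t=\bigcup_{s\succeq t}U_s$. For $K>1$, a $K$-tree-covering of $\Omega$ is a tree-covering $\{U_t\}_{t\in\Gamma}$ with $U_t=\frac{17}{16}\operatorname{int}(Q_t)$ (concentric dilation) for a Whitney decomposition $\{Q_t\}_{t\in\Gamma}$ of $\Omega$, in which cubes $Q_s,Q_t$ with $s,t$ adjacent in the tree share an $(n-1)$-dimensional face, and $Q_s\subseteq KQ_t$ whenever $s\succeq t$. Let $x_t$ be the center of $Q_t$. Exponents are Lebesgue measurable functions $q(\cdot):\Omega\to[1,\infty]$; $q_-(E)$, $q_+(E)$ are the essential infimum and supremum of $q$ over $E\cap\Omega$, and $q_\pm=q_\pm(\Omega)$. For $\tau\ge1$, $q(\cdot)\in\partial LH_0^\tau(\Omega)$ means that for some constant $C_0$, $q_+(B_{x,\tau})-q_-(B_{x,\tau})\le C_0/(-\log(\tau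 d(x)))$ for all $x\in\Omega$ with $\tau d(x)\le\frac12$. $L^{q(\cdot)}(\Omega)$ is the variable Lebesgue space with the Luxemburg norm $\|f\|_{q(\cdot)}=\inf\{c>0:\rho(f/c)\le1\}$, where $\rho(f)=\int_{\{q<\infty\}}|f(x)|^{q(x)}\,dx+\|f\|_{L^\infty(\{q=\infty\})}$. Theorem. Let $n\ge1$ and $K>1$. (i) There is $\tau\ge1$, depending only on $n$ and $K$, such that $W_t\subseteq B_{x_t,\tau}$ for all $t\in\Gamma$, for every bounded John domain $\Omega\subset\mathbb R^n$ and every $K$-tree-covering $\{U_t\}_{t\in\Gamma}$ of $\Omega$. (ii) Let $\Omega\subset\mathbb R^n$ be a bounded John domain with a $K$-tree-covering $\{U_t\}_{t\in\Gamma}$, let $\tau_K\ge1$ be any constant with $W_t\subseteq B_{x_t,\tau_K}$ for all $t\in\Gamma$, and let $q(\cdot)\in\partial LH_0^{\tau_K}(\Omega)$ with $1<q_-\le q_+<\infty$. Then there is a constant $C$ such that for every real-valued $g\in L^{q(\cdot)}(\Omega)$ with $\int_\Omega g\,dx=0$ there are functions $g_t\in L^1(\Omega)$, $t\in\Gamma$,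 with $g=\sum_{t\in\Gamma}g_t$ a.e. in $\Omega$, $\operatorname{supp}g_t\subseteq U_t$ and $\int_{U_t}g_t\,dx=0$ for all $t\in\Gamma$, and $$\Big\|\sum_{t\in\Gamma}\chi_{U_t}\frac{\|\chi_{U_t}g_t\|_{q(\cdot)}}{\|\chi_{U_t}\|_{q(\cdot)}}\Big\|_{q(\cdot)}\le C\|g\|_{q(\cdot)}.$$ -/

import Mathlib

open MeasureTheory Set
open scoped ENNReal NNReal

universe u

noncomputable section

namespace JohnDecomposition

/-! ### Domains and John domains -/

/-- A bounded domain of `ℝⁿ`: a nonempty, connected, open and bounded set. -/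
def IsBoundedDomain {n : ℕ} (Ω : Set (EuclideanSpace ℝ (Fin n))) : Prop :=
  IsOpen Ω ∧ IsConnected Ω ∧ Bornology.IsBounded Ω

/-- `d(x)`, the distance from `x` to the boundary of `Ω`. -/
def bdist {n : ℕ} (Ω : Set (EuclideanSpace ℝ (Fin n))) (x : EuclideanSpace ℝ (Fin n)) : ℝ :=
  Metric.infDist x (frontier Ω)

/-- `B_{x,τ} = B(x, τ d(x))`. -/
def bball {n : ℕ} (Ω : Set (EuclideanSpace ℝ (Fin n))) (τ : ℝ) (x : EuclideanSpace ℝ (Fin n)) :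
    Set (EuclideanSpace ℝ (Fin n)) :=
  Metric.ball x (τ * bdist Ω x)

/-- `Ω` is a bounded John domain. `HasUnitSpeedOn γ (Icc 0 ℓ)` says that the length of `γ` between
two parameters is their difference: `γ` is rectifiable and parametrized by arc length. -/
def IsBoundedJohnDomain {n : ℕ} (Ω : Set (EuclideanSpace ℝ (Fin n))) : Prop :=
  IsBoundedDomain Ω ∧
    ∃ lam : ℝ, 1 < lam ∧ ∃ x₀ ∈ Ω, ∀ y ∈ Ω,
      ∃ (ℓ : ℝ) (γ : ℝ → EuclideanSpace ℝ (Fin n)),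
        0 ≤ ℓ ∧ HasUnitSpeedOn γ (Icc 0 ℓ) ∧ γ 0 = y ∧ γ ℓ = x₀ ∧
          ∀ t ∈ Icc 0 ℓ, γ t ∈ Ω ∧ t ≤ lam * bdist Ω (γ t)

/-! ### Dyadic cubes and Whitney decompositions -/

/-- The index data `(k, m)` of the closed dyadic cube `∏ᵢ [mᵢ 2⁻ᵏ, (mᵢ + 1) 2⁻ᵏ]`. -/
structure DyadicCube (n : ℕ) where
  scale : ℤ
  corner : Fin n → ℤ

namespace DyadicCube

/-- The side length `2⁻ᵏ`. -/
def side {n : ℕ} (Q : DyadicCube n) : ℝ := (2 : ℝ) ^ (-Q.scale)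

/-- The closed cube as a set. -/
def carrier {n : ℕ} (Q : DyadicCube n) : Set (EuclideanSpace ℝ (Fin n)) :=
  {x | ∀ i, (Q.corner i : ℝ) * Q.side ≤ x i ∧ x i ≤ ((Q.corner i : ℝ) + 1) * Q.side}

/-- The center of the cube. -/
def center {n : ℕ} (Q : DyadicCube n) : EuclideanSpace ℝ (Fin n) :=
  WithLp.toLp 2 fun i => ((Q.corner i : ℝ) + 1 / 2) * Q.side

/-- `c Q`: the closed cube with the same center and `c` times the side length. -/
def dilate {n : ℕ} (c : ℝ) (Q : DyadicCube n) : Set (EuclideanSpace ℝ (Fin n)) :=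
  {x | ∀ i, |x i - Q.center i| ≤ c * Q.side / 2}

/-- `c int(Q)`: the open cube with the same center and `c` times the side length. -/
def openDilate {n : ℕ} (c : ℝ) (Q : DyadicCube n) : Set (EuclideanSpace ℝ (Fin n)) :=
  {x | ∀ i, |x i - Q.center i| < c * Q.side / 2}

end DyadicCube

/-- The distance between two sets, `inf {|x - y| : x ∈ A, y ∈ B}`. -/
def setDist {n : ℕ} (A B : Set (EuclideanSpace ℝ (Fin n))) : ℝ :=
  sInf (Set.image2 dist A B)

/-- `{Q_t}` is a Whitney decomposition of `Ω`. -/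
structure IsWhitneyDecomposition {n : ℕ} (Ω : Set (EuclideanSpace ℝ (Fin n))) {Γ : Type u}
    (Q : Γ → DyadicCube n) : Prop where
  iUnion_eq : ⋃ t, (Q t).carrier = Ω
  disjoint_interior : ∀ s t, s ≠ t → Disjoint (interior (Q s).carrier) (interior (Q t).carrier)
  diam_le : ∀ t, Metric.diam (Q t).carrier ≤ setDist (Q t).carrier (frontier Ω)
  le_diam : ∀ t, setDist (Q t).carrier (frontier Ω) ≤ 4 * Metric.diam (Q t).carrier
  comparable : ∀ s t, ((Q s).carrier ∩ (Q t).carrier).Nonempty →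
    1 / 4 * Metric.diam (Q s).carrier ≤ Metric.diam (Q t).carrier ∧
      Metric.diam (Q t).carrier ≤ 4 * Metric.diam (Q s).carrier

/-- Two cubes share an `(n-1)`-dimensional face: their intersection is nonempty and its affine span
has dimension `n - 1`. -/
def SharesFace {n : ℕ} (Q R : DyadicCube n) : Prop :=
  (Q.carrier ∩ R.carrier).Nonempty ∧
    Module.finrank ℝ (vectorSpan ℝ (Q.carrier ∩ R.carrier)) + 1 = n

/-! ### Rooted trees and tree-coverings -/

/-- The order of the tree `G` with root `a`: `s ⪯ t` iff the path from `t` to the root passes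
through `s`. -/
def TreeLE {Γ : Type u} (G : SimpleGraph Γ) (a s t : Γ) : Prop :=
  ∃ p : G.Walk t a, p.IsPath ∧ s ∈ p.support

/-- `r` is the parent of `t`: it is adjacent to `t` and on the path from `t` to the root. -/
def IsParent {Γ : Type u} (G : SimpleGraph Γ) (a r t : Γ) : Prop :=
  G.Adj r t ∧ TreeLE G a r t

/-- `{U_t}` is a tree-covering of `Ω`, with respect to the tree `G` with root `a`. -/
structure IsTreeCovering {n : ℕ} (Ω : Set (EuclideanSpace ℝ (Fin n))) {Γ : Type u}
    (U : Γ → Set (EuclideanSpace ℝ (Fin n))) (G : SimpleGraph Γ) (a : Γ) : Prop where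
  isOpen : ∀ t, IsOpen (U t)
  iUnion_eq : ⋃ t, U t = Ω
  overlap : ∃ C₁ : ℝ≥0, 1 ≤ C₁ ∧ ∀ᵐ x ∂(volume.restrict Ω),
    1 ≤ ∑' t, (U t).indicator (fun _ => (1 : ℝ≥0∞)) x ∧
      ∑' t, (U t).indicator (fun _ => (1 : ℝ≥0∞)) x ≤ C₁
  isTree : G.IsTree
  exists_pieces : ∃ (B : Γ → Set (EuclideanSpace ℝ (Fin n))) (C₂ : ℝ≥0),
    (∀ t, t ≠ a → IsOpen (B t)) ∧
    (∀ s t, s ≠ a → t ≠ a → s ≠ t → Disjoint (B s) (B t)) ∧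
    (∀ t r, t ≠ a → IsParent G a r t → B t ⊆ U t ∩ U r) ∧
    (∀ t, t ≠ a → volume (U t) ≤ C₂ * volume (B t))

/-- `U_t = (17/16) int(Q_t)`. -/
def expanded {n : ℕ} {Γ : Type u} (Q : Γ → DyadicCube n) (t : Γ) :
    Set (EuclideanSpace ℝ (Fin n)) :=
  (Q t).openDilate (17 / 16)

/-- The shadow `W_t = ⋃_{s ⪰ t} U_s`. -/
def shadow {n : ℕ} {Γ : Type u} (Q : Γ → DyadicCube n) (G : SimpleGraph Γ) (a t : Γ) :
    Set (EuclideanSpace ℝ (Fin n)) :=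
  ⋃ s ∈ {s | TreeLE G a t s}, expanded Q s

/-- The tree-coverings of John domains: `U_t = (17/16) int(Q_t)` for a Whitney decomposition
`{Q_t}` of `Ω`, cubes adjacent in the tree share a face, and `Q_s ⊆ K Q_t` whenever `s ⪰ t`. -/
structure IsJohnTreeCovering {n : ℕ} (Ω : Set (EuclideanSpace ℝ (Fin n))) {Γ : Type u}
    (Q : Γ → DyadicCube n) (G : SimpleGraph Γ) (a : Γ) (K : ℝ) : Prop where
  whitney : IsWhitneyDecomposition Ω Q
  treeCovering : IsTreeCovering Ω (expanded Q) G a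
  face : ∀ s t, G.Adj s t → SharesFace (Q s) (Q t)
  subset_dilate : ∀ s t, TreeLE G a t s → (Q s).carrier ⊆ (Q t).dilate K

/-- `τ ≥ 1` is a constant with `W_t ⊆ B_{x_t,τ}` for every `t`, where `x_t` is the center
of `Q_t`. -/
def IsShadowConstant {n : ℕ} (Ω : Set (EuclideanSpace ℝ (Fin n))) {Γ : Type u}
    (Q : Γ → DyadicCube n) (G : SimpleGraph Γ) (a : Γ) (τ : ℝ) : Prop :=
  1 ≤ τ ∧ ∀ t, shadow Q G a t ⊆ bball Ω τ (Q t).center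

/-! ### Variable exponents and variable Lebesgue spaces -/

/-- `𝒫(Ω)`: the Lebesgue measurable `q : Ω → [1,∞]` (values off `Ω` are irrelevant). -/
def IsExponent {n : ℕ} (Ω : Set (EuclideanSpace ℝ (Fin n)))
    (q : EuclideanSpace ℝ (Fin n) → ℝ≥0∞) : Prop :=
  AEMeasurable q (volume.restrict Ω) ∧ ∀ x ∈ Ω, 1 ≤ q x

/-- `q_-(E)`, for `E ⊆ Ω`. -/
def expMinus {n : ℕ} (q : EuclideanSpace ℝ (Fin n) → ℝ≥0∞)
    (E : Set (EuclideanSpace ℝ (Fin n))) : ℝ≥0∞ :=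
  essInf q (volume.restrict E)

/-- `q_+(E)`, for `E ⊆ Ω`. -/
def expPlus {n : ℕ} (q : EuclideanSpace ℝ (Fin n) → ℝ≥0∞)
    (E : Set (EuclideanSpace ℝ (Fin n))) : ℝ≥0∞ :=
  essSup q (volume.restrict E)

/-- The boundary log-Hölder condition `∂LH₀^τ(Ω)`:
`q_+(B_{x,τ}) - q_-(B_{x,τ}) ≤ C₀ / (-log (τ d(x)))` for all `x ∈ Ω` with `τ d(x) ≤ 1/2`.
As `q` lives on `Ω`, the ball `B_{x,τ}` is intersected with `Ω`. -/
def BoundaryLogHolder {n : ℕ} (Ω : Set (EuclideanSpace ℝ (Fin n))) (τ : ℝ)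
    (q : EuclideanSpace ℝ (Fin n) → ℝ≥0∞) : Prop :=
  ∃ C₀ : ℝ, 0 ≤ C₀ ∧ ∀ x ∈ Ω, τ * bdist Ω x ≤ 1 / 2 →
    expPlus q (bball Ω τ x ∩ Ω) ≤
      expMinus q (bball Ω τ x ∩ Ω) + ENNReal.ofReal (C₀ / -Real.log (τ * bdist Ω x))

/-- The modular `ρ_{q(·)}(F) = ∫_{q < ∞} F^{q(x)} dx + ‖F‖_{L^∞({q = ∞})}` on `Ω`, as a function
of the absolute value `F` of a function. -/
def modular {n : ℕ} (Ω : Set (EuclideanSpace ℝ (Fin n)))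
    (q : EuclideanSpace ℝ (Fin n) → ℝ≥0∞) (F : EuclideanSpace ℝ (Fin n) → ℝ≥0∞) : ℝ≥0∞ :=
  (∫⁻ x in Ω ∩ {x | q x ≠ ∞}, F x ^ (q x).toReal) +
    essSup F (volume.restrict (Ω ∩ {x | q x = ∞}))

/-- The Luxemburg norm `inf {c > 0 : ρ_{q(·)}(F / c) ≤ 1}` of a function with absolute value `F`;
it is `∞` if there is no such `c`. -/
def luxNorm {n : ℕ} (Ω : Set (EuclideanSpace ℝ (Fin n)))
    (q : EuclideanSpace ℝ (Fin n) → ℝ≥0∞) (F : EuclideanSpace ℝ (Fin n) → ℝ≥0∞) : ℝ≥0∞ :=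
  sInf {r | ∃ c : ℝ, 0 < c ∧ modular Ω q (fun x => F x / ENNReal.ofReal c) ≤ 1 ∧
    r = ENNReal.ofReal c}

/-- `f ∈ L^{q(·)}(Ω)`. -/
def MemVarLp {n : ℕ} (Ω : Set (EuclideanSpace ℝ (Fin n)))
    (q : EuclideanSpace ℝ (Fin n) → ℝ≥0∞) (f : EuclideanSpace ℝ (Fin n) → ℝ) : Prop :=
  AEMeasurable f (volume.restrict Ω) ∧
    ∃ c : ℝ, 0 < c ∧ modular Ω q (fun x => ‖f x‖ₑ / ENNReal.ofReal c) < ∞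

/-! ### Decompositions -/

/-- `{g_t}` is a decomposition of `g` subordinate to `{U_t}`. -/
structure IsDecomposition {n : ℕ} (Ω : Set (EuclideanSpace ℝ (Fin n))) {Γ : Type u}
    (U : Γ → Set (EuclideanSpace ℝ (Fin n))) (g : EuclideanSpace ℝ (Fin n) → ℝ)
    (gt : Γ → EuclideanSpace ℝ (Fin n) → ℝ) : Prop where
  integrable : ∀ t, IntegrableOn (gt t) Ω
  hasSum : ∀ᵐ x ∂(volume.restrict Ω), HasSum (fun t => gt t x) (g x)
  tsupport_subset : ∀ t, tsupport (gt t) ⊆ U t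
  integral_eq_zero : ∀ t, ∫ x in U t, gt t x = 0

/-- The function `∑_t χ_{U_t} ‖χ_{U_t} g_t‖_{q(·)} / ‖χ_{U_t}‖_{q(·)}`. -/
def localNormSum {n : ℕ} (Ω : Set (EuclideanSpace ℝ (Fin n))) {Γ : Type u}
    (U : Γ → Set (EuclideanSpace ℝ (Fin n))) (q : EuclideanSpace ℝ (Fin n) → ℝ≥0∞)
    (gt : Γ → EuclideanSpace ℝ (Fin n) → ℝ) (x : EuclideanSpace ℝ (Fin n)) : ℝ≥0∞ :=
  ∑' t, (U t).indicator (fun _ =>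
    luxNorm Ω q (fun y => ‖(U t).indicator (gt t) y‖ₑ) /
      luxNorm Ω q ((U t).indicator fun _ => 1)) x

end JohnDecomposition

end

open JohnDecomposition

/-! Let `D t` be the interior of `Q t` and `S t` the union of the `D s` with `s ⪰ t`. To repair the
means of the pieces `χ_{D t} g`, each vertex sends the surplus `∫_{S t} g` to its parent: the
transfer `T_t` is a constant on a set `E t ⊆ U_t ∩ U_{t_p}` with integral `∫_{S t} g`, and `g_t =
χ_{D t} g - T_t + ∑_{children s} T_s`. The sum telescopes to `g`, and `∫ g_t = 0` because `S t` is
the disjoint union of `D t` and the `S s` of the children; at the root nothing is sent, since `S a`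
is almost all of `Ω` and `∫ g = 0` (`isDecomposition_treePart`).

As `|E t|` is comparable to `|D t|`, the transfers are dominated by the tree averages `A_t = |D t|⁻¹
∫_{S t} |g|` placed on the disjoint sets `E t`. That this Hardy operator is bounded
(`exists_tsum_setLIntegral_rpow_le`) rests on two facts. Descendants of `t` occupy volume at most
`Kⁿ |D t|`; applied at all vertices of a generation, this self-improves to geometric decay in the
generation, hence to a weighted bound with weights `b ^ depth`, `b > 1`
(`exists_exponential_weight`). Hölder's inequality with those weights then leaves a geometric factor
that can be summed over ancestors.

The variable exponent is frozen at `r t`, the infimum of `q` over the ball `B_{x_t,τ}`. That ball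
contains the whole shadow of `t`, so `r t` is a lower bound for `q` everywhere the average looks.
Returning from `r t` to `q x` costs a factor governed by `|D t| ^ -(R t - r t)`, where `R t` is the
supremum over the same ball; the boundary log-Hölder condition bounds exactly this quantity, since
the side of `Q t` is comparable to the distance to the boundary (`exists_exponent_bounds`).

The same quantity controls the local quotients of norms: for `f` of modular at most one, their
modular over `U_t` is bounded by `|U_t| + ∫_{U_t} f^q`, which bounded overlap sums
(`exists_lintegral_local_average_rpow_le`). Part (i) is a comparison of side lengths
(`isShadowConstant`). -/

namespace JohnDecomposition

/-! ### Orders of rooted trees -/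

/-- The combinatorial properties of the order `le` of a rooted tree with depth function `dep`. -/
structure IsTreeOrder {Γ : Type u} (le : Γ → Γ → Prop) (dep : Γ → ℕ) : Prop where
  refl : ∀ t, le t t
  trans : ∀ {r s t}, le r s → le s t → le r t
  dep_le : ∀ {s t}, le s t → dep s ≤ dep t
  inj : ∀ {r s t}, le r t → le s t → dep r = dep s → r = s
  exists_between : ∀ {s t} (m : ℕ), le s t → dep s + m ≤ dep t →
    ∃ r, le s r ∧ le r t ∧ dep r = dep s + m

section Tree

variable {Γ : Type u} {G : SimpleGraph Γ} {a : Γ}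

theorem path_eq_of_isTree (hG : G.IsTree) {s t : Γ} {p q : G.Walk s t} (hp : p.IsPath)
    (hq : q.IsPath) : p = q :=
  (hG.existsUnique_path s t).unique hp hq

theorem length_eq_dist_of_isTree (hG : G.IsTree) {s t : Γ} {p : G.Walk s t} (hp : p.IsPath) :
    p.length = G.dist s t := by
  obtain ⟨q, hq, hql⟩ := hG.1.exists_path_of_dist s t
  rw [path_eq_of_isTree hG hp hq, hql]

theorem treeLE_iff_of_isPath (hG : G.IsTree) {s t : Γ} {p : G.Walk t a} (hp : p.IsPath) :
    TreeLE G a s t ↔ ∃ m ≤ p.length, p.getVert m = s := by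
  constructor
  · rintro ⟨q, hq, hs⟩
    rw [path_eq_of_isTree hG hq hp] at hs
    obtain ⟨m, h1, h2⟩ := SimpleGraph.Walk.mem_support_iff_exists_getVert.1 hs
    exact ⟨m, h2, h1⟩
  · rintro ⟨m, h2, h1⟩
    exact ⟨p, hp, SimpleGraph.Walk.mem_support_iff_exists_getVert.2 ⟨m, h1, h2⟩⟩

theorem dist_getVert_of_isPath (hG : G.IsTree) {t : Γ} {p : G.Walk t a} (hp : p.IsPath) (m : ℕ) :
    G.dist (p.getVert m) a = p.length - m := by
  rw [← length_eq_dist_of_isTree hG (hp.drop m), SimpleGraph.Walk.drop_length]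

theorem treeLE_getVert_getVert (hG : G.IsTree) {t : Γ} {p : G.Walk t a} (hp : p.IsPath)
    {i j : ℕ} (hij : i ≤ j) (hj : j ≤ p.length) :
    TreeLE G a (p.getVert j) (p.getVert i) := by
  rw [treeLE_iff_of_isPath hG (hp.drop i)]
  refine ⟨j - i, ?_, ?_⟩
  · rw [SimpleGraph.Walk.drop_length]; omega
  · rw [SimpleGraph.Walk.drop_getVert]; congr 1; omega

/-- The vertices below `t` are those on the unique path from `t` to the root, and along that path
the distance to the root drops by one at each step, so everything reduces to arithmetic of indices
on one path. -/
theorem isTreeOrder_treeLE (hG : G.IsTree) (a : Γ) :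
    IsTreeOrder (TreeLE G a) (fun t => G.dist t a) where
  refl t := by
    obtain ⟨p, hp, -⟩ := hG.existsUnique_path t a
    exact ⟨p, hp, p.start_mem_support⟩
  trans := by
    intro r s t hrs hst
    obtain ⟨p, hp, -⟩ := hG.existsUnique_path t a
    obtain ⟨i, hi, rfl⟩ := (treeLE_iff_of_isPath hG hp).1 hst
    obtain ⟨j, hj, rfl⟩ := (treeLE_iff_of_isPath hG (hp.drop i)).1 hrs
    rw [SimpleGraph.Walk.drop_length] at hj
    exact (treeLE_iff_of_isPath hG hp).2
      ⟨i + j, by omega, (SimpleGraph.Walk.drop_getVert p i j).symm⟩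
  dep_le := by
    intro s t hst
    obtain ⟨p, hp, -⟩ := hG.existsUnique_path t a
    obtain ⟨i, hi, rfl⟩ := (treeLE_iff_of_isPath hG hp).1 hst
    rw [dist_getVert_of_isPath hG hp, ← length_eq_dist_of_isTree hG hp]
    omega
  inj := by
    intro r s t hr hs h
    obtain ⟨p, hp, -⟩ := hG.existsUnique_path t a
    obtain ⟨i, hi, rfl⟩ := (treeLE_iff_of_isPath hG hp).1 hr
    obtain ⟨j, hj, rfl⟩ := (treeLE_iff_of_isPath hG hp).1 hs
    simp only [dist_getVert_of_isPath hG hp] at h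
    congr 1
    omega
  exists_between := by
    intro s t m hst h
    obtain ⟨p, hp, -⟩ := hG.existsUnique_path t a
    obtain ⟨i, hi, rfl⟩ := (treeLE_iff_of_isPath hG hp).1 hst
    simp only [dist_getVert_of_isPath hG hp, ← length_eq_dist_of_isTree hG hp] at h ⊢
    refine ⟨p.getVert (i - m), treeLE_getVert_getVert hG hp (by omega) hi,
      (treeLE_iff_of_isPath hG hp).2 ⟨i - m, by omega, rfl⟩, ?_⟩
    rw [dist_getVert_of_isPath hG hp]
    omega

theorem isParent_iff (hG : G.IsTree) {s t : Γ} :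
    IsParent G a s t ↔ TreeLE G a s t ∧ G.dist t a = G.dist s a + 1 := by
  obtain ⟨p, hp, -⟩ := hG.existsUnique_path t a
  constructor
  · rintro ⟨hadj, hle⟩
    refine ⟨hle, ?_⟩
    obtain ⟨i, hi, rfl⟩ := (treeLE_iff_of_isPath hG hp).1 hle
    have h1 := hadj.symm.diff_dist_adj (u := a)
    rw [SimpleGraph.dist_comm (u := a) (v := t), SimpleGraph.dist_comm (u := a)] at h1
    rw [dist_getVert_of_isPath hG hp, ← length_eq_dist_of_isTree hG hp] at h1 ⊢
    have hi0 : i ≠ 0 := by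
      rintro rfl
      simp at hadj
    omega
  · rintro ⟨hle, h⟩
    refine ⟨?_, hle⟩
    obtain ⟨i, hi, rfl⟩ := (treeLE_iff_of_isPath hG hp).1 hle
    rw [dist_getVert_of_isPath hG hp, ← length_eq_dist_of_isTree hG hp] at h
    obtain rfl : i = 1 := by omega
    have := p.adj_getVert_succ (i := 0) (by omega)
    simpa using this.symm

theorem treeLE_root (hG : G.IsTree) (t : Γ) : TreeLE G a a t := by
  obtain ⟨p, hp, -⟩ := hG.existsUnique_path t a
  exact ⟨p, hp, p.end_mem_support⟩

end Tree

namespace IsTreeOrder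

variable {Γ : Type u} {le : Γ → Γ → Prop} {dep : Γ → ℕ}

/-- If the total weight above every vertex is controlled by its own weight, then the weight is still
controlled after giving exponentially growing weight to the generations. -/
theorem exists_exponential_weight (h : IsTreeOrder le dep) (w : Γ → ℝ≥0∞) (C : ℝ≥0)
    (hw : ∀ t, w t ≠ ∞)
    (hC : ∀ t, ∑' s, {s | le t s}.indicator w s ≤ C * w t) :
    ∃ (b : ℝ≥0) (A : ℝ≥0), 1 < b ∧ ∀ t,
      ∑' s, {s | le t s}.indicator (fun s => (b : ℝ≥0∞) ^ (dep s - dep t) * w s) s ≤ A * w t := by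
  classical
  -- The enlargement makes `C' > 1`, so that `θ = 1 - 1 / C'` lies strictly between 0 and 1.
  set C' : ℝ≥0 := C + 2 with hC'
  have hCC : ∀ t, ∑' s, {s | le t s}.indicator w s ≤ C' * w t := fun t =>
    (hC t).trans (by gcongr; simp [hC'])
  set R : Γ → ℕ → ℝ≥0∞ := fun t m => ∑' s, {s | le t s ∧ dep t + m ≤ dep s}.indicator w s with hR
  set L : Γ → ℕ → ℝ≥0∞ := fun t m => ∑' s, {s | le t s ∧ dep s = dep t + m}.indicator w s with hL
  have hsplit : ∀ t m, R t m = R t (m + 1) + L t m := by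
    intro t m
    rw [hR, hL]
    simp only
    rw [← ENNReal.tsum_add]
    congr 1; ext s
    simp only [indicator_apply, mem_ofPred_eq]
    by_cases h1 : le t s
    · simp only [h1, true_and]
      rcases lt_trichotomy (dep s) (dep t + m) with h2 | h2 | h2
      · rw [if_neg (by omega), if_neg (by omega), if_neg (by omega), add_zero]
      · rw [if_pos (by omega), if_neg (by omega), if_pos (by omega), zero_add]
      · rw [if_pos (by omega), if_pos (by omega), if_neg (by omega), add_zero]
    · simp [h1]
  -- Every vertex at least `m` generations above `t` lies above some vertex of generation exactly
  -- `m`; the hypothesis is applied at each of those.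
  have hRL : ∀ t m, R t m ≤ C' * L t m := by
    intro t m
    calc R t m ≤ ∑' s, ∑' r, {r | le t r ∧ dep r = dep t + m}.indicator
          (fun r => {s | le r s}.indicator w s) r := by
          refine ENNReal.tsum_le_tsum fun s => ?_
          by_cases hs : le t s ∧ dep t + m ≤ dep s
          · obtain ⟨r, h1, h2, h3⟩ := h.exists_between m hs.1 hs.2
            refine le_trans ?_ (ENNReal.le_tsum r)
            rw [indicator_of_mem (show s ∈ {s | le t s ∧ dep t + m ≤ dep s} from hs),
              indicator_of_mem (show r ∈ {r | le t r ∧ dep r = dep t + m} from ⟨h1, h3⟩),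
              indicator_of_mem (show s ∈ {s | le r s} from h2)]
          · rw [indicator_of_notMem (by exact hs)]
            exact zero_le
      _ = ∑' r, {r | le t r ∧ dep r = dep t + m}.indicator
          (fun r => ∑' s, {s | le r s}.indicator w s) r := by
          rw [ENNReal.tsum_comm]
          congr 1; ext r
          by_cases hr : r ∈ {r | le t r ∧ dep r = dep t + m}
          · simp only [indicator_of_mem hr]
          · simp only [indicator_of_notMem hr, tsum_zero]
      _ ≤ ∑' r, C' * {r | le t r ∧ dep r = dep t + m}.indicator w r := by
          refine ENNReal.tsum_le_tsum fun r => ?_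
          by_cases hr : r ∈ {r | le t r ∧ dep r = dep t + m}
          · simp only [indicator_of_mem hr]; exact hCC r
          · simp only [indicator_of_notMem hr, mul_zero, le_refl]
      _ = C' * L t m := ENNReal.tsum_mul_left
  have hR0 : ∀ t, R t 0 ≤ C' * w t := by
    intro t
    refine le_trans (ENNReal.tsum_le_tsum fun s => ?_) (hCC t)
    exact indicator_le_indicator_of_subset (fun s hs => hs.1) (fun _ => zero_le) s
  have hRfin : ∀ t m, R t m ≠ ∞ := by
    intro t m
    induction m with
    | zero => exact ne_top_of_le_ne_top (ENNReal.mul_ne_top ENNReal.coe_ne_top (hw t)) (hR0 t)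
    | succ m ih => exact ne_top_of_le_ne_top ih (by rw [hsplit t m]; exact le_self_add)
  set θ : ℝ≥0 := (C' - 1) / C' with hθ
  have hC'1 : (1 : ℝ≥0) ≤ C' := by rw [hC']; exact le_trans (by norm_num) le_add_self
  have hC'0 : C' ≠ 0 := (lt_of_lt_of_le one_pos hC'1).ne'
  have hθ0 : 0 < θ := by
    rw [hθ]
    refine div_pos (tsub_pos_of_lt ?_) (pos_iff_ne_zero.2 hC'0)
    rw [hC']
    exact lt_of_lt_of_le (by norm_num) le_add_self
  have hθ1 : θ < 1 := by
    rw [hθ, div_lt_one (pos_iff_ne_zero.2 hC'0)]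
    exact tsub_lt_self (pos_iff_ne_zero.2 hC'0) one_pos
  -- Since `L` is at least the fraction `1 / C'` of the tail `R`, removing one generation shrinks
  -- the tail by the factor `θ`.
  have hstep : ∀ t m, R t (m + 1) ≤ θ * R t m := by
    intro t m
    have h1 := hsplit t m
    have h2 := hRL t m
    have hf1 := hRfin t (m + 1)
    have hf0 := hRfin t m
    have hfL : L t m ≠ ∞ := ne_top_of_le_ne_top hf0 (by rw [h1]; exact le_add_self)
    lift R t (m + 1) to ℝ≥0 using hf1 with x
    lift R t m to ℝ≥0 using hf0 with y
    lift L t m to ℝ≥0 using hfL with z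
    norm_cast at h1 h2 ⊢
    rw [hθ, div_mul_eq_mul_div, le_div_iff₀ (pos_iff_ne_zero.2 hC'0)]
    have : ((C' - 1 : ℝ≥0) : ℝ) = C' - 1 := NNReal.coe_sub hC'1
    rw [← NNReal.coe_le_coe] at h2 ⊢
    push_cast [this, h1] at h2 ⊢
    nlinarith
  have hpow : ∀ t m, R t m ≤ θ ^ m * (C' * w t) := by
    intro t m
    induction m with
    | zero => simpa using hR0 t
    | succ m ih =>
      refine (hstep t m).trans ?_
      rw [pow_succ', mul_assoc]
      gcongr
  -- The square root splits the decay in half: `b > 1`, while `b * θ = b⁻¹ < 1` still gives a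
  -- convergent series.
  set b : ℝ≥0 := NNReal.sqrt θ⁻¹ with hb
  have hb1 : 1 < b := by
    by_contra! hle
    have h2 : b * b = θ⁻¹ := by rw [hb, NNReal.mul_self_sqrt]
    exact ((one_lt_inv₀ hθ0).2 hθ1).not_ge (h2 ▸ mul_le_one' hle hle)
  have hbθ : b * θ = b⁻¹ := by
    have h2 : b * b = θ⁻¹ := by rw [hb, NNReal.mul_self_sqrt]
    have hb0 : b ≠ 0 := (one_pos.trans hb1).ne'
    field_simp
    rw [pow_two, h2, inv_mul_cancel₀ hθ0.ne']
  refine ⟨b, (1 - b⁻¹)⁻¹ * C', hb1, fun t => ?_⟩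
  have hbi : b⁻¹ < 1 := inv_lt_one_of_one_lt₀ hb1
  calc ∑' s, {s | le t s}.indicator (fun s => (b : ℝ≥0∞) ^ (dep s - dep t) * w s) s
      ≤ ∑' s, ∑' m : ℕ, (b : ℝ≥0∞) ^ m * {s | le t s ∧ dep t + m ≤ dep s}.indicator w s := by
        refine ENNReal.tsum_le_tsum fun s => ?_
        by_cases hs : le t s
        · refine le_trans ?_ (ENNReal.le_tsum (dep s - dep t))
          have := h.dep_le hs
          rw [indicator_of_mem (by exact hs), indicator_of_mem]
          exact ⟨hs, by omega⟩
        · rw [indicator_of_notMem (by exact hs)]; exact zero_le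
    _ = ∑' m : ℕ, (b : ℝ≥0∞) ^ m * R t m := by
        rw [ENNReal.tsum_comm]
        simp only [ENNReal.tsum_mul_left, hR]
    _ ≤ ∑' m : ℕ, ((b⁻¹ : ℝ≥0) : ℝ≥0∞) ^ m * (C' * w t) := by
        refine ENNReal.tsum_le_tsum fun m => ?_
        calc (b : ℝ≥0∞) ^ m * R t m ≤ (b : ℝ≥0∞) ^ m * (θ ^ m * (C' * w t)) := by
              gcongr; exact hpow t m
          _ = ((b * θ : ℝ≥0) : ℝ≥0∞) ^ m * (C' * w t) := by
              rw [← mul_assoc, ← mul_pow, ENNReal.coe_mul]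
          _ = _ := by rw [hbθ]
    _ = _ := by
        rw [ENNReal.tsum_mul_right, ENNReal.tsum_geometric, ENNReal.coe_mul, mul_assoc,
          ENNReal.coe_inv (tsub_pos_of_lt hbi).ne', ENNReal.coe_sub, ENNReal.coe_one]

/-- A geometric sum over the vertices below a given one. -/
theorem tsum_pow_dep_sub_le (h : IsTreeOrder le dep) (c : ℝ≥0∞) (s : Γ) :
    ∑' t, {t | le t s}.indicator (fun t => c ^ (dep s - dep t)) t ≤ (1 - c)⁻¹ := by
  rw [← tsum_subtype, ← ENNReal.tsum_geometric]
  -- The vertices below `s` form a chain with distinct depths, so the sum is part of a geometric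
  -- series.
  refine ENNReal.tsum_comp_le_tsum_of_injective (f := fun t : {t | le t s} => dep s - dep t)
    (fun t r htr => ?_) (fun m => c ^ m)
  have h1 := h.dep_le t.2
  have h2 := h.dep_le r.2
  simp only at htr
  exact Subtype.ext (h.inj t.2 r.2 (by omega))

end IsTreeOrder

/-! ### A Hardy inequality on trees for variable exponents -/

theorem tsum_rpow_mul_rpow_le {Γ : Type u} (f g : Γ → ℝ≥0∞) {p q : ℝ} (hp : 0 ≤ p) (hq : 0 ≤ q)
    (hpq : p + q = 1) :
    ∑' s, f s ^ p * g s ^ q ≤ (∑' s, f s) ^ p * (∑' s, g s) ^ q := by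
  let _ : MeasurableSpace Γ := ⊤
  simp only [← lintegral_count]
  exact ENNReal.lintegral_mul_norm_pow_le measurable_from_top.aemeasurable
    measurable_from_top.aemeasurable hp hq hpq

/-- A weighted Hölder inequality over the vertices above `t`. -/
theorem rpow_inv_mul_tsum_le {Γ : Type u} {le : Γ → Γ → Prop} {dep : Γ → ℕ} {w : Γ → ℝ≥0∞}
    {b A : ℝ≥0} (hb : 1 < b) {t : Γ} (hw0 : w t ≠ 0) (hw : w t ≠ ∞)
    (hA : ∑' s, {s | le t s}.indicator (fun s => (b : ℝ≥0∞) ^ (dep s - dep t) * w s) s ≤ A * w t)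
    {p r : ℝ} (hp : 1 < p) (hpr : p ≤ r) (φ g : Γ → ℝ≥0∞)
    (hg : ∀ s, le t s → g s ≤ φ s ^ (1 / r) * w s ^ (1 - 1 / r)) :
    w t * ((w t)⁻¹ * ∑' s, {s | le t s}.indicator g s) ^ r ≤
      (A : ℝ≥0∞) ^ (r - 1) *
        ∑' s, {s | le t s}.indicator
          (fun s => ((b : ℝ≥0∞) ^ (-(p - 1))) ^ (dep s - dep t) * φ s) s := by
  have hr : 1 < r := hp.trans_le hpr
  have hr0 : 0 < r := by linarith
  have h1r : 0 ≤ 1 - 1 / r := by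
    rw [sub_nonneg, div_le_one hr0]; exact hr.le
  have hb0 : (b : ℝ≥0∞) ≠ 0 := by
    simpa using (one_pos.trans hb).ne'
  have hbt : (b : ℝ≥0∞) ≠ ∞ := ENNReal.coe_ne_top
  -- With this choice `c ^ (1 / r) * b ^ (1 - 1 / r) = b ^ ((r - p) / r) ≥ 1` for every `r ≥ p`. One
  -- ratio `c < 1` thus serves all the local exponents `r t` at once.
  set c : ℝ≥0∞ := (b : ℝ≥0∞) ^ (-(p - 1)) with hc
  have hsum : ∑' s, {s | le t s}.indicator g s ≤
      (∑' s, {s | le t s}.indicator (fun s => c ^ (dep s - dep t) * φ s) s) ^ (1 / r) *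
        (A * w t) ^ (1 - 1 / r) := by
    refine le_trans ?_ ((tsum_rpow_mul_rpow_le (p := 1 / r) (q := 1 - 1 / r)
      ({s | le t s}.indicator (fun s => c ^ (dep s - dep t) * φ s))
      ({s | le t s}.indicator (fun s => (b : ℝ≥0∞) ^ (dep s - dep t) * w s))
      (by positivity) h1r (by ring)).trans
      (by gcongr))
    refine ENNReal.tsum_le_tsum fun s => ?_
    by_cases hs : s ∈ {s | le t s}
    · simp only [indicator_of_mem hs]
      refine (hg s hs).trans ?_
      have hone : (1 : ℝ≥0∞) ≤
          (c ^ (dep s - dep t)) ^ (1 / r) * ((b : ℝ≥0∞) ^ (dep s - dep t)) ^ (1 - 1 / r) := by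
        rw [hc, ← ENNReal.rpow_natCast, ← ENNReal.rpow_natCast, ← ENNReal.rpow_mul,
          ← ENNReal.rpow_mul, ← ENNReal.rpow_mul, ← ENNReal.rpow_add _ _ hb0 hbt]
        have : -(p - 1) * (((dep s - dep t : ℕ) : ℝ) * (1 / r)) +
            ((dep s - dep t : ℕ) : ℝ) * (1 - 1 / r) =
            ((dep s - dep t : ℕ) : ℝ) * ((r - p) / r) := by
          field_simp; ring
        rw [this]
        have hrp : 0 ≤ r - p := by linarith
        rw [← ENNReal.one_rpow (((dep s - dep t : ℕ) : ℝ) * ((r - p) / r))]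
        exact ENNReal.rpow_le_rpow (by exact_mod_cast hb.le) (by positivity)
      rw [ENNReal.mul_rpow_of_nonneg _ _ (by positivity : 0 ≤ 1 / r),
        ENNReal.mul_rpow_of_nonneg _ _ h1r]
      calc φ s ^ (1 / r) * w s ^ (1 - 1 / r) = 1 * (φ s ^ (1 / r) * w s ^ (1 - 1 / r)) := by
            rw [one_mul]
        _ ≤ _ := by
            refine (mul_le_mul_left hone _).trans (le_of_eq ?_)
            ring
    · simp only [indicator_of_notMem hs]
      exact zero_le
  set S := ∑' s, {s | le t s}.indicator (fun s => c ^ (dep s - dep t) * φ s) s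
  calc w t * ((w t)⁻¹ * ∑' s, {s | le t s}.indicator g s) ^ r
      ≤ w t * ((w t)⁻¹ * (S ^ (1 / r) * (A * w t) ^ (1 - 1 / r))) ^ r := by
        gcongr
    _ = w t * ((w t)⁻¹ ^ r * (S * (A ^ (r - 1) * w t ^ (r - 1)))) := by
        rw [ENNReal.mul_rpow_of_nonneg _ _ hr0.le, ENNReal.mul_rpow_of_nonneg _ _ hr0.le,
          ← ENNReal.rpow_mul, ← ENNReal.rpow_mul, ← ENNReal.mul_rpow_of_nonneg _ _ (by linarith),
          one_div_mul_cancel hr0.ne', ENNReal.rpow_one]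
        congr 5
        field_simp
    _ = (w t * (w t ^ (r - 1) * w t ^ (-r))) * (A ^ (r - 1) * S) := by
        rw [ENNReal.inv_rpow, ENNReal.rpow_neg]; ring
    _ = A ^ (r - 1) * S := by
        rw [← ENNReal.rpow_add _ _ hw0 hw]
        rw [show r - 1 + -r = -1 by ring, ENNReal.rpow_neg_one, ENNReal.mul_inv_cancel hw0 hw,
          one_mul]

/-- The added 1 pays for `x ≤ 1`, where lowering the exponent goes the wrong way. -/
theorem le_one_add_rpow_rpow {x : ℝ≥0∞} {r q : ℝ} (hr : 0 < r) (hrq : r ≤ q) :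
    x ≤ (1 + x ^ q) ^ (1 / r) := by
  rw [← ENNReal.rpow_le_rpow_iff hr, ← ENNReal.rpow_mul, one_div_mul_cancel hr.ne',
    ENNReal.rpow_one]
  rcases le_total x 1 with h | h
  · exact (ENNReal.rpow_le_one h hr.le).trans le_self_add
  · exact (ENNReal.rpow_le_rpow_of_exponent_le h hrq).trans le_add_self

/-- If `x` is at most `M / w` and the oscillation of the exponent is small compared to `w`, then the
exponent can be lowered. -/
theorem rpow_le_one_add_mul_rpow {x w M : ℝ≥0∞} {L : ℝ≥0∞} {r R P q : ℝ} (hM : 1 ≤ M)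
    (hx : x ≤ w⁻¹ * M) (hr : 0 ≤ r) (hrq : r ≤ q) (hqR : q ≤ R) (hRP : R ≤ P)
    (hL : w⁻¹ ^ (R - r) ≤ L) : x ^ q ≤ 1 + M ^ P * L * x ^ r := by
  rcases le_total x 1 with h | h
  · exact (ENNReal.rpow_le_one h (hr.trans hrq)).trans le_self_add
  · refine le_trans ?_ le_add_self
    calc x ^ q ≤ x ^ (R - r + r) := ENNReal.rpow_le_rpow_of_exponent_le h (by linarith)
      _ = x ^ (R - r) * x ^ r := ENNReal.rpow_add_of_nonneg _ _ (by linarith) hr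
      _ ≤ (w⁻¹ * M) ^ (R - r) * x ^ r := by
          gcongr; linarith
      _ = M ^ (R - r) * w⁻¹ ^ (R - r) * x ^ r := by
          rw [ENNReal.mul_rpow_of_nonneg _ _ (by linarith), mul_comm (w⁻¹ ^ _)]
      _ ≤ _ := by
          gcongr
          linarith

/-! ### From weights on vertices to integrals with a variable exponent. -/

section Hardy

variable {X : Type*} [MeasurableSpace X] {μ : Measure X} {Γ : Type u}
  [Countable Γ]

theorem tsum_setLIntegral_le {D : Γ → Set X} (hD : ∀ t, MeasurableSet (D t))
    (hDd : Pairwise (Function.onFun Disjoint D)) (f : X → ℝ≥0∞) :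
    ∑' t, ∫⁻ x in D t, f x ∂μ ≤ ∫⁻ x, f x ∂μ := by
  rw [← lintegral_iUnion hD hDd]
  exact setLIntegral_le_lintegral _ _

/-- Modular form of the boundedness of the Hardy operator. With `F = 1 + g^q` one has `g ≤ F ^ (1 /
r t)` on every `D s` with `s` above `t`, so Hölder on `D s` gives the hypothesis of
`rpow_inv_mul_tsum_le` with `φ s = ∫_{D s} F`. The total mass of `F` is at most `1 + μ univ`, which
makes the final bound independent of `g`. -/
theorem exists_tsum_setLIntegral_rpow_le [IsFiniteMeasure μ] {le : Γ → Γ → Prop} {dep : Γ → ℕ}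
    (h : IsTreeOrder le dep) {D E : Γ → Set X} (hD : ∀ t, MeasurableSet (D t))
    (hDd : Pairwise (Function.onFun Disjoint D)) (hE : ∀ t, MeasurableSet (E t))
    (hEd : Pairwise (Function.onFun Disjoint E)) {q : X → ℝ} (hq : AEMeasurable q μ)
    (hq1 : ∀ᵐ x ∂μ, 1 ≤ q x) {p P : ℝ} {r R : Γ → ℝ} (hp : 1 < p) (hpr : ∀ t, p ≤ r t)
    (hrR : ∀ t, r t ≤ R t) (hRP : ∀ t, R t ≤ P)
    (hqD : ∀ t s, le t s → ∀ᵐ x ∂μ, x ∈ D s → r t ≤ q x)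
    (hqE : ∀ t, ∀ᵐ x ∂μ, x ∈ E t → r t ≤ q x ∧ q x ≤ R t) (hD0 : ∀ t, μ (D t) ≠ 0)
    {L C : ℝ≥0} (hL : ∀ t, (μ (D t))⁻¹ ^ (R t - r t) ≤ L)
    (hC : ∀ t, ∑' s, {s | le t s}.indicator (fun s => μ (D s)) s ≤ C * μ (D t))
    (hEC : ∀ t, μ (E t) ≤ C * μ (D t)) :
    ∃ C' : ℝ≥0, ∀ g : X → ℝ≥0∞, AEMeasurable g μ → ∫⁻ x, g x ^ q x ∂μ ≤ 1 →
      ∑' t, ∫⁻ x in E t, ((μ (D t))⁻¹ *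
        ∑' s, {s | le t s}.indicator (fun s => ∫⁻ y in D s, g y ∂μ) s) ^ q x ∂μ ≤ C' := by
  obtain ⟨b, A, hb, hA⟩ := h.exists_exponential_weight (fun s => μ (D s)) C
    (fun t => measure_ne_top _ _) hC
  set M : ℝ≥0∞ := 1 + μ univ with hM
  have hM1 : 1 ≤ M := le_self_add
  have hMt : M ≠ ∞ := by simp [hM]
  set c : ℝ≥0∞ := (b : ℝ≥0∞) ^ (-(p - 1)) with hc
  have hc1 : c < 1 := by
    rw [hc, ENNReal.rpow_neg, ENNReal.inv_lt_one]
    exact ENNReal.one_lt_rpow (by exact_mod_cast hb) (by linarith)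
  set A' : ℝ≥0∞ := max 1 (A : ℝ≥0∞) with hA'
  set B : ℝ≥0∞ := M ^ P * L * C * A' ^ P with hB
  have hP0 : 0 ≤ P ∨ IsEmpty Γ := by
    rcases isEmpty_or_nonempty Γ with h0 | ⟨⟨t⟩⟩
    · exact Or.inr h0
    · left; linarith [hpr t, hrR t, hRP t]
  rcases hP0 with hP0 | hemp
  swap
  · exact ⟨0, fun g _ _ => by simp⟩
  have hfin : μ univ + B * ((1 - c)⁻¹ * M) ≠ ∞ := by
    have h1 : (1 - c)⁻¹ ≠ ∞ := by simpa [tsub_eq_zero_iff_le] using hc1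
    have h2 : A' ≠ ∞ := by simp [hA']
    have h3 : A' ^ P ≠ ∞ := ENNReal.rpow_ne_top_of_nonneg hP0 h2
    have h4 : M ^ P ≠ ∞ := ENNReal.rpow_ne_top_of_nonneg hP0 hMt
    finiteness
  refine ⟨(μ univ + B * ((1 - c)⁻¹ * M)).toNNReal, fun g hg hg1 => ?_⟩
  rw [ENNReal.coe_toNNReal hfin]
  set F : X → ℝ≥0∞ := fun x => 1 + g x ^ q x with hF
  have hFm : AEMeasurable F μ := (hg.pow hq).const_add 1
  have hFint : ∫⁻ x, F x ∂μ ≤ M := by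
    rw [hF, lintegral_add_left' aemeasurable_const, hM, add_comm]
    gcongr
    simp
  have hgF : ∀ᵐ x ∂μ, g x ≤ F x := by
    filter_upwards [hq1] with x hx
    simpa using le_one_add_rpow_rpow (x := g x) one_pos hx
  have hgint : ∫⁻ x, g x ∂μ ≤ M := (lintegral_mono_ae hgF).trans hFint
  set φ : Γ → ℝ≥0∞ := fun s => ∫⁻ x in D s, F x ∂μ with hφ
  set S : Γ → ℝ≥0∞ := fun t => ∑' s, {s | le t s}.indicator (fun s => ∫⁻ y in D s, g y ∂μ) s
    with hS
  have hSM : ∀ t, S t ≤ M := by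
    intro t
    refine le_trans (ENNReal.tsum_le_tsum fun s => ?_)
      ((tsum_setLIntegral_le hD hDd g).trans hgint)
    exact indicator_le_self' (fun _ _ => zero_le) s
  have hholder : ∀ t, μ (D t) * ((μ (D t))⁻¹ * S t) ^ r t ≤
      A' ^ P * ∑' s, {s | le t s}.indicator (fun s => c ^ (dep s - dep t) * φ s) s := by
    intro t
    have hr1 : 1 < r t := hp.trans_le (hpr t)
    have hrt : 0 < r t := by linarith
    refine (rpow_inv_mul_tsum_le (w := fun s => μ (D s)) hb (hD0 t) (measure_ne_top _ _) (hA t) hp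
      (hpr t) φ _ ?_).trans ?_
    · intro s hs
      calc ∫⁻ y in D s, g y ∂μ ≤ ∫⁻ y in D s, F y ^ (1 / r t) * 1 ^ (1 - 1 / r t) ∂μ := by
            refine lintegral_mono_ae ?_
            filter_upwards [ae_restrict_of_ae (hqD t s hs), ae_restrict_mem (hD s)] with y hy hyD
            rw [ENNReal.one_rpow, mul_one]
            exact le_one_add_rpow_rpow hrt (hy hyD)
        _ ≤ _ := by
            refine (ENNReal.lintegral_mul_norm_pow_le (hFm.restrict) aemeasurable_const
              (by positivity) ?_ (by ring)).trans (by simp [hφ])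
            rw [sub_nonneg, div_le_one hrt]; exact hr1.le
    · gcongr
      calc (A : ℝ≥0∞) ^ (r t - 1) ≤ A' ^ (r t - 1) := by
            gcongr
            exact le_max_right _ _
        _ ≤ A' ^ P := ENNReal.rpow_le_rpow_of_exponent_le (le_max_left _ _)
            (by linarith [hrR t, hRP t])
  have hlocal : ∀ t, ∫⁻ x in E t, ((μ (D t))⁻¹ * S t) ^ q x ∂μ ≤ μ (E t) +
      B * ∑' s, {s | le t s}.indicator (fun s => c ^ (dep s - dep t) * φ s) s := by
    intro t
    have hr1 : 1 < r t := hp.trans_le (hpr t)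
    -- The average is at most `M / μ (D t)`, because `∫ g ≤ M`; this crude bound is what allows `q
    -- x` to be lowered to `r t` at the cost `M ^ P * L`.
    calc ∫⁻ x in E t, ((μ (D t))⁻¹ * S t) ^ q x ∂μ
        ≤ ∫⁻ x in E t, 1 + M ^ P * L * ((μ (D t))⁻¹ * S t) ^ r t ∂μ := by
          refine lintegral_mono_ae ?_
          filter_upwards [ae_restrict_of_ae (hqE t), ae_restrict_mem (hE t)] with x hx hxE
          exact rpow_le_one_add_mul_rpow hM1 (by gcongr; exact hSM t) (by linarith) (hx hxE).1
            (hx hxE).2 (hRP t) (hL t)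
      _ = μ (E t) + M ^ P * L * ((μ (D t))⁻¹ * S t) ^ r t * μ (E t) := by
          rw [setLIntegral_const, add_mul, one_mul]
      _ ≤ μ (E t) + M ^ P * L * ((μ (D t))⁻¹ * S t) ^ r t * (C * μ (D t)) := by
          gcongr; exact hEC t
      _ = μ (E t) + M ^ P * L * C * (μ (D t) * ((μ (D t))⁻¹ * S t) ^ r t) := by ring
      _ ≤ μ (E t) + M ^ P * L * C * (A' ^ P *
            ∑' s, {s | le t s}.indicator (fun s => c ^ (dep s - dep t) * φ s) s) := by
          gcongr _ + _ * ?_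
          exact hholder t
      _ = _ := by rw [hB]; ring
  calc ∑' t, ∫⁻ x in E t, ((μ (D t))⁻¹ * S t) ^ q x ∂μ
      ≤ ∑' t, (μ (E t) +
          B * ∑' s, {s | le t s}.indicator (fun s => c ^ (dep s - dep t) * φ s) s) :=
        ENNReal.tsum_le_tsum hlocal
    -- Exchanging the sums, the mass `φ s` is charged to the vertices below `s` with weights `c ^
    -- (dep s - dep t)`, of total at most `(1 - c)⁻¹`.
    _ = ∑' t, μ (E t) +
          B * ∑' s, (∑' t, {t | le t s}.indicator (fun t => c ^ (dep s - dep t)) t) * φ s := by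
        rw [ENNReal.tsum_add, ENNReal.tsum_mul_left, ENNReal.tsum_comm]
        congr 2
        refine tsum_congr fun s => ?_
        rw [← ENNReal.tsum_mul_right]
        refine tsum_congr fun t => ?_
        by_cases hts : le t s
        · rw [indicator_of_mem (by exact hts), indicator_of_mem (by exact hts)]
        · rw [indicator_of_notMem (by exact hts), indicator_of_notMem (by exact hts), zero_mul]
    _ ≤ μ univ + B * ∑' s, (1 - c)⁻¹ * φ s := by
        gcongr with s
        · rw [← measure_iUnion hEd hE]
          exact measure_mono (subset_univ _)
        · exact h.tsum_pow_dep_sub_le c s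
    _ ≤ μ univ + B * ((1 - c)⁻¹ * M) := by
        rw [ENNReal.tsum_mul_left]
        gcongr
        exact (tsum_setLIntegral_le hD hDd F).trans hFint

end Hardy

/-! ### The Luxemburg norm and local averages -/

section Luxemburg

variable {n : ℕ} {Ω : Set (EuclideanSpace ℝ (Fin n))} {q : EuclideanSpace ℝ (Fin n) → ℝ≥0∞}

theorem modular_eq_lintegral (hΩ : MeasurableSet Ω) (hq : ∀ᵐ x ∂(volume.restrict Ω), q x ≠ ∞)
    (F : EuclideanSpace ℝ (Fin n) → ℝ≥0∞) :
    modular Ω q F = ∫⁻ x in Ω, F x ^ (q x).toReal := by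
  rw [ae_restrict_iff' hΩ] at hq
  have h1 : (Ω ∩ {x | q x ≠ ∞} : Set _) =ᵐ[volume] Ω := by
    filter_upwards [hq] with x hx
    exact propext ⟨fun h => h.1, fun h => ⟨h, hx h⟩⟩
  have h2 : volume (Ω ∩ {x | q x = ∞}) = 0 := by
    refine measure_mono_null (fun x hx => ?_) (ae_iff.1 hq)
    intro h
    exact h hx.1 hx.2
  rw [modular, Measure.restrict_congr_set h1, Measure.restrict_eq_zero.2 h2, essSup_measure_zero,
    bot_eq_zero, add_zero]

theorem luxNorm_le_ofReal {F : EuclideanSpace ℝ (Fin n) → ℝ≥0∞} {c : ℝ} (hc : 0 < c)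
    (h : modular Ω q (fun x => F x / ENNReal.ofReal c) ≤ 1) : luxNorm Ω q F ≤ ENNReal.ofReal c :=
  sInf_le ⟨c, hc, h, rfl⟩

theorem exists_modular_le_of_luxNorm_lt {F : EuclideanSpace ℝ (Fin n) → ℝ≥0∞} {N : ℝ≥0∞}
    (h : luxNorm Ω q F < N) :
    ∃ c : ℝ, 0 < c ∧ modular Ω q (fun x => F x / ENNReal.ofReal c) ≤ 1 ∧ ENNReal.ofReal c < N := by
  obtain ⟨_, ⟨c, hc, hm, rfl⟩, hlt⟩ := sInf_lt_iff.1 h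
  exact ⟨c, hc, hm, hlt⟩

theorem modular_mono {F F' : EuclideanSpace ℝ (Fin n) → ℝ≥0∞} (h : ∀ x, F x ≤ F' x) :
    modular Ω q F ≤ modular Ω q F' := by
  unfold modular
  gcongr with x
  · exact h x
  · exact essSup_mono_ae (Filter.Eventually.of_forall h)

theorem luxNorm_le_mul {F F' : EuclideanSpace ℝ (Fin n) → ℝ≥0∞} {k : ℝ} (hk : 0 < k)
    (h : ∀ x, F x ≤ ENNReal.ofReal k * F' x) :
    luxNorm Ω q F ≤ ENNReal.ofReal k * luxNorm Ω q F' := by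
  have hk0 : ENNReal.ofReal k ≠ 0 := by simpa using hk
  rw [mul_comm, ← ENNReal.div_le_iff hk0 ENNReal.ofReal_ne_top]
  refine le_sInf ?_
  rintro _ ⟨c, hc, hm, rfl⟩
  rw [ENNReal.div_le_iff hk0 ENNReal.ofReal_ne_top, ← ENNReal.ofReal_mul hc.le]
  refine luxNorm_le_ofReal (by positivity) ((modular_mono fun x => ?_).trans hm)
  rw [ENNReal.div_le_iff (by simpa using by positivity) ENNReal.ofReal_ne_top]
  refine (h x).trans (le_of_eq ?_)
  rw [ENNReal.ofReal_mul hc.le, ← mul_assoc,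
    ENNReal.div_mul_cancel (by simpa using hc) ENNReal.ofReal_ne_top, mul_comm]

variable {X : Type*} [MeasurableSpace X] {μ : Measure X}

/-- As `q ≥ 1`, division by `B ≥ 1` gains at least one full factor `B⁻¹`; this turns a modular bound
`B` into a norm bound `B`. -/
theorem lintegral_div_rpow_le {q : X → ℝ} (hq1 : ∀ᵐ x ∂μ, 1 ≤ q x) (F : X → ℝ≥0∞) {B : ℝ≥0∞}
    (hB : 1 ≤ B) : ∫⁻ x, (F x / B) ^ q x ∂μ ≤ B⁻¹ * ∫⁻ x, F x ^ q x ∂μ := by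
  rw [← lintegral_const_mul' _ _ (by simpa using (one_pos.trans_le hB).ne')]
  refine lintegral_mono_ae ?_
  filter_upwards [hq1] with x hx
  rw [div_eq_mul_inv, ENNReal.mul_rpow_of_nonneg _ _ (by linarith), mul_comm]
  gcongr
  calc B⁻¹ ^ q x ≤ B⁻¹ ^ (1 : ℝ) :=
        ENNReal.rpow_le_rpow_of_exponent_ge (ENNReal.inv_le_one.2 hB) hx
    _ = B⁻¹ := ENNReal.rpow_one _

theorem lintegral_indicator_div_rpow {q : X → ℝ} (hq1 : ∀ᵐ x ∂μ, 1 ≤ q x) {U : Set X}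
    (hU : MeasurableSet U) (f : X → ℝ≥0∞) (c : ℝ≥0∞) :
    ∫⁻ x, (U.indicator f x / c) ^ q x ∂μ = ∫⁻ x in U, (f x / c) ^ q x ∂μ := by
  rw [← lintegral_indicator hU]
  refine lintegral_congr_ae ?_
  filter_upwards [hq1] with x hx
  by_cases hxU : x ∈ U
  · simp [hxU]
  · simp [hxU, show 0 < q x by linarith]

/-- On a set where the exponent oscillates little, the quotient of the norms of `χ_U f` and `χ_U` is
controlled by the modular of `χ_U f`. -/
theorem setLIntegral_luxNorm_div_rpow_le (hΩ : MeasurableSet Ω)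
    (hfin : ∀ᵐ x ∂(volume.restrict Ω), q x ≠ ∞)
    (hq1 : ∀ᵐ x ∂(volume.restrict Ω), 1 ≤ (q x).toReal)
    {U : Set (EuclideanSpace ℝ (Fin n))} (hU : MeasurableSet U) (hU0 : volume.restrict Ω U ≠ 0)
    {r R P : ℝ} (hr : 1 ≤ r) (hrR : r ≤ R) (hRP : R ≤ P)
    (hqU : ∀ᵐ x ∂(volume.restrict Ω), x ∈ U → r ≤ (q x).toReal ∧ (q x).toReal ≤ R)
    {L : ℝ≥0∞} (hL : (volume.restrict Ω U)⁻¹ ^ (R - r) ≤ L)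
    {f : EuclideanSpace ℝ (Fin n) → ℝ≥0∞}
    (hf1 : ∫⁻ x in Ω, f x ^ (q x).toReal ≤ 1) :
    ∫⁻ x in U, (luxNorm Ω q (U.indicator f) / luxNorm Ω q (U.indicator fun _ => 1)) ^ (q x).toReal
        ∂(volume.restrict Ω) ≤
      2 ^ P * (volume.restrict Ω U +
        2 ^ P * L * ∫⁻ x in U, f x ^ (q x).toReal ∂(volume.restrict Ω)) := by
  set μ := volume.restrict Ω with hμ
  set N := luxNorm Ω q (U.indicator f) with hN
  set M := luxNorm Ω q (U.indicator fun _ => 1) with hM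
  have hmod : ∀ (f : EuclideanSpace ℝ (Fin n) → ℝ≥0∞) (c : ℝ≥0∞),
      modular Ω q (fun x => U.indicator f x / c) = ∫⁻ x in U, (f x / c) ^ (q x).toReal ∂μ := by
    intro f c
    rw [modular_eq_lintegral hΩ hfin, lintegral_indicator_div_rpow hq1 hU]
  have hN1 : N ≤ 1 := by
    rw [← ENNReal.ofReal_one]
    refine luxNorm_le_ofReal one_pos ?_
    rw [hmod]
    simp only [ENNReal.ofReal_one, div_one]
    exact (setLIntegral_le_lintegral _ _).trans hf1
  have hq1U : ∀ᵐ x ∂(μ.restrict U), 1 ≤ (q x).toReal := ae_restrict_of_ae hq1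
  have hqU' : ∀ᵐ x ∂(μ.restrict U), r ≤ (q x).toReal ∧ (q x).toReal ≤ R := by
    filter_upwards [ae_restrict_of_ae hqU, ae_restrict_mem hU] with x hx hxU using hx hxU
  -- Were the norm of `χ_U` zero, some `c` below both 1 and `μ U` would be admissible; but then `∫_U
  -- c ^ (-q) ≥ μ U / c > 1`.
  have hM0 : M ≠ 0 := by
    intro h0
    obtain ⟨c, hc, hm, hlt⟩ := exists_modular_le_of_luxNorm_lt (Ω := Ω) (q := q)
      (F := U.indicator fun _ => 1) (N := min 1 (μ U))
      (by rw [← hM, h0]; exact lt_min one_pos (pos_iff_ne_zero.2 hU0))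
    rw [hmod] at hm
    have hc0 : ENNReal.ofReal c ≠ 0 := by simpa using hc
    have hc1 : ENNReal.ofReal c ≤ 1 := (hlt.trans_le (min_le_left _ _)).le
    have h1 : ∫⁻ _ in U, (ENNReal.ofReal c)⁻¹ ∂μ ≤ 1 := by
      refine le_trans (lintegral_mono_ae ?_) hm
      filter_upwards [hq1U] with x hx
      rw [one_div]
      calc (ENNReal.ofReal c)⁻¹ = (ENNReal.ofReal c)⁻¹ ^ (1 : ℝ) := (ENNReal.rpow_one _).symm
        _ ≤ _ := ENNReal.rpow_le_rpow_of_exponent_le (ENNReal.one_le_inv.2 hc1) hx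
    rw [setLIntegral_const, mul_comm, ← div_eq_mul_inv,
      ENNReal.div_le_iff hc0 ENNReal.ofReal_ne_top, one_mul] at h1
    exact absurd (hlt.trans_le (min_le_right _ _)) h1.not_gt
  -- If `N ≤ μ U`, then `N ^ r ≤ N` suffices. Otherwise `N⁻¹ < (μ U)⁻¹`, so the oscillation bound
  -- `L` allows `N ^ r` to be replaced by `N ^ R`, and this is controlled by the modular of `f`.
  have hNr : N ^ r ≤ μ U + 2 ^ P * L * ∫⁻ x in U, f x ^ (q x).toReal ∂μ := by
    rcases le_or_gt N (μ U) with h | h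
    · calc N ^ r ≤ N ^ (1 : ℝ) := ENNReal.rpow_le_rpow_of_exponent_ge hN1 hr
        _ = N := ENNReal.rpow_one _
        _ ≤ _ := h.trans le_self_add
    · have hN0 : N ≠ 0 := (zero_le.trans_lt h).ne'
      have hNt : N ≠ ∞ := ne_top_of_le_ne_top ENNReal.one_ne_top hN1
      have hhalf0 : N / 2 ≠ 0 := by simp [hN0]
      have hhalft : N / 2 ≠ ∞ := by finiteness
      have hR0 : 0 ≤ R := by linarith
      -- The constant `N / 2` is smaller than the norm, hence not admissible: `∫_U (f / (N / 2))^q ≥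
      -- 1`. As `N / 2 ≤ 1`, the power of `(N / 2)⁻¹` taken out is at most `R`.
      have hlow : (N / 2) ^ R ≤ ∫⁻ x in U, f x ^ (q x).toReal ∂μ := by
        have h1 : 1 ≤ ∫⁻ x in U, (f x / (N / 2)) ^ (q x).toReal ∂μ := by
          by_contra! hlt
          have := luxNorm_le_ofReal (Ω := Ω) (q := q) (F := U.indicator f)
            (c := (N / 2).toReal) (ENNReal.toReal_pos hhalf0 hhalft)
            (by rw [hmod, ENNReal.ofReal_toReal hhalft]; exact hlt.le)
          rw [ENNReal.ofReal_toReal hhalft, ← hN] at this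
          exact absurd this (ENNReal.half_lt_self hN0 hNt).not_ge
        have h2 : ∫⁻ x in U, (f x / (N / 2)) ^ (q x).toReal ∂μ ≤
            ((N / 2) ^ R)⁻¹ * ∫⁻ x in U, f x ^ (q x).toReal ∂μ := by
          rw [← lintegral_const_mul' _ _ (by simp [hhalf0, hhalft])]
          refine lintegral_mono_ae ?_
          filter_upwards [hqU'] with x hx
          rw [div_eq_mul_inv, ENNReal.mul_rpow_of_nonneg _ _ (by linarith), mul_comm,
            ← ENNReal.inv_rpow]
          gcongr
          · rw [ENNReal.one_le_inv]
            exact ENNReal.half_le_self.trans hN1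
          · exact hx.2
        have h3 := h1.trans h2
        rw [mul_comm, ← div_eq_mul_inv, ENNReal.le_div_iff_mul_le (Or.inl (by simp [hhalf0, hhalft]))
          (Or.inl (by simp [hhalft, hhalf0])), one_mul] at h3
        exact h3
      refine le_trans ?_ le_add_self
      calc N ^ r = N ^ (-(R - r)) * N ^ R := by
            rw [← ENNReal.rpow_add _ _ hN0 hNt]; congr 1; ring
        _ = N⁻¹ ^ (R - r) * (2 ^ R * (N / 2) ^ R) := by
            rw [ENNReal.rpow_neg, ENNReal.inv_rpow, ← ENNReal.mul_rpow_of_nonneg _ _ hR0,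
              ENNReal.mul_div_cancel (by simp) (by simp)]
        _ ≤ L * (2 ^ P * ∫⁻ x in U, f x ^ (q x).toReal ∂μ) := by
            gcongr
            · exact (ENNReal.rpow_le_rpow (ENNReal.inv_le_inv.2 h.le) (by linarith)).trans hL
            · norm_num
        _ = _ := by ring
  -- The factor 2 avoids having to show that the infimum defining `M` is attained. For `M = ∞` the
  -- integrand vanishes, `∞⁻¹` being 0.
  have hMint : ∫⁻ x in U, (2 * M)⁻¹ ^ (q x).toReal ∂μ ≤ 1 := by
    rcases eq_or_ne M ∞ with hMt | hMt
    · refine le_trans (le_of_eq ?_) zero_le_one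
      rw [lintegral_eq_zero_of_ae_eq_zero]
      filter_upwards [hq1U] with x hx
      simp [hMt, show 0 < (q x).toReal by linarith]
    · obtain ⟨c, hc, hm, hlt⟩ := exists_modular_le_of_luxNorm_lt (Ω := Ω) (q := q)
        (F := U.indicator fun _ => 1) (N := 2 * M)
        (by rw [← hM, two_mul]; exact ENNReal.lt_add_right hMt hM0)
      rw [hmod] at hm
      refine le_trans (lintegral_mono fun x => ?_) hm
      rw [one_div]
      gcongr
  calc ∫⁻ x in U, (N / M) ^ (q x).toReal ∂μ
      ≤ ∫⁻ x in U, (2 ^ P * N ^ r) * (2 * M)⁻¹ ^ (q x).toReal ∂μ := by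
        refine lintegral_mono_ae ?_
        filter_upwards [hqU'] with x hx
        have hq0 : 0 ≤ (q x).toReal := by linarith
        have h1 : N / M = 2 * N * (2 * M)⁻¹ := by
          rw [← div_eq_mul_inv, ENNReal.mul_div_mul_left _ _ (by simp) (by simp)]
        rw [h1, ENNReal.mul_rpow_of_nonneg _ _ hq0, ENNReal.mul_rpow_of_nonneg _ _ hq0]
        gcongr ?_ * ?_ * _
        · exact ENNReal.rpow_le_rpow_of_exponent_le (by norm_num) (hx.2.trans hRP)
        · exact ENNReal.rpow_le_rpow_of_exponent_ge hN1 hx.1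
    _ = 2 ^ P * N ^ r * ∫⁻ x in U, (2 * M)⁻¹ ^ (q x).toReal ∂μ := by
        rw [lintegral_const_mul']
        have : N ≠ ∞ := ne_top_of_le_ne_top ENNReal.one_ne_top hN1
        exact ENNReal.mul_ne_top (ENNReal.rpow_ne_top_of_nonneg (by linarith) (by simp))
          (ENNReal.rpow_ne_top_of_nonneg (by linarith) this)
    _ ≤ 2 ^ P * N ^ r * 1 := by gcongr
    _ ≤ _ := by rw [mul_one]; gcongr

/-- Hölder for sums, paired with the counting function of the cover, which is at most `C` at `x`. -/
theorem tsum_indicator_rpow_le {Γ : Type u} {Y : Type*} {U : Γ → Set Y} {x : Y} {C : ℝ≥0∞}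
    (hC1 : 1 ≤ C)
    (hC : ∑' t, (U t).indicator (fun _ => (1 : ℝ≥0∞)) x ≤ C) (f : Γ → ℝ≥0∞) {q P : ℝ}
    (hq : 1 ≤ q) (hqP : q ≤ P) :
    (∑' t, (U t).indicator (fun _ => f t) x) ^ q ≤
      C ^ P * ∑' t, (U t).indicator (fun _ => f t ^ q) x := by
  have hq0 : 0 < q := by linarith
  have hq' : 0 ≤ 1 - 1 / q := by rw [sub_nonneg, div_le_one hq0]; exact hq
  have h1 : ∑' t, (U t).indicator (fun _ => f t) x ≤
      (∑' t, (U t).indicator (fun _ => f t ^ q) x) ^ (1 / q) * C ^ (1 - 1 / q) := by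
    refine le_trans ?_ ((tsum_rpow_mul_rpow_le (p := 1 / q) (q := 1 - 1 / q)
      (fun t => (U t).indicator (fun _ => f t ^ q) x)
      (fun t => (U t).indicator (fun _ => (1 : ℝ≥0∞)) x) (by positivity) hq' (by ring)).trans
      (by gcongr))
    refine ENNReal.tsum_le_tsum fun t => ?_
    by_cases hx : x ∈ U t
    · simp only [indicator_of_mem hx, ENNReal.one_rpow, mul_one]
      rw [← ENNReal.rpow_mul, mul_one_div_cancel hq0.ne', ENNReal.rpow_one]
    · simp only [indicator_of_notMem hx]; exact zero_le
  calc _ ≤ ((∑' t, (U t).indicator (fun _ => f t ^ q) x) ^ (1 / q) * C ^ (1 - 1 / q)) ^ q := by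
        gcongr
    _ = C ^ (q - 1) * ∑' t, (U t).indicator (fun _ => f t ^ q) x := by
        rw [ENNReal.mul_rpow_of_nonneg _ _ hq0.le, ← ENNReal.rpow_mul, ← ENNReal.rpow_mul,
          one_div_mul_cancel hq0.ne', ENNReal.rpow_one, mul_comm]
        congr 2
        field_simp
    _ ≤ _ := by
        gcongr
        linarith

theorem tsum_setLIntegral_le_of_overlap {Γ : Type u} [Countable Γ] {U : Γ → Set X}
    (hU : ∀ t, MeasurableSet (U t)) {C : ℝ≥0∞}
    (hC : ∀ᵐ x ∂μ, ∑' t, (U t).indicator (fun _ => (1 : ℝ≥0∞)) x ≤ C) {f : X → ℝ≥0∞}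
    (hf : AEMeasurable f μ) : ∑' t, ∫⁻ x in U t, f x ∂μ ≤ C * ∫⁻ x, f x ∂μ := by
  calc ∑' t, ∫⁻ x in U t, f x ∂μ = ∑' t, ∫⁻ x, (U t).indicator f x ∂μ := by
        simp only [lintegral_indicator (hU _)]
    _ = ∫⁻ x, ∑' t, (U t).indicator f x ∂μ := by
        rw [lintegral_tsum fun t => hf.indicator (hU t)]
    _ ≤ ∫⁻ x, C * f x ∂μ := by
        refine lintegral_mono_ae ?_
        filter_upwards [hC] with x hx
        calc ∑' t, (U t).indicator f x
            = ∑' t, (U t).indicator (fun _ => (1 : ℝ≥0∞)) x * f x := by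
              refine tsum_congr fun t => ?_
              by_cases hxt : x ∈ U t <;> simp [hxt]
          _ ≤ C * f x := by rw [ENNReal.tsum_mul_right]; gcongr
    _ = C * ∫⁻ x, f x ∂μ := lintegral_const_mul'' _ hf

/-- Local averages with respect to the Luxemburg norm are bounded, in terms of modulars. -/
theorem exists_lintegral_local_average_rpow_le {Γ : Type u} [Countable Γ] (hΩ : MeasurableSet Ω)
    (hΩt : volume Ω ≠ ∞) (hqm : AEMeasurable q (volume.restrict Ω))
    (hfin : ∀ᵐ x ∂(volume.restrict Ω), q x ≠ ∞)
    (hq1 : ∀ᵐ x ∂(volume.restrict Ω), 1 ≤ (q x).toReal)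
    {U : Γ → Set (EuclideanSpace ℝ (Fin n))} (hU : ∀ t, MeasurableSet (U t))
    (hU0 : ∀ t, volume.restrict Ω (U t) ≠ 0)
    {P : ℝ} {r R : Γ → ℝ} (hr : ∀ t, 1 ≤ r t) (hrR : ∀ t, r t ≤ R t) (hRP : ∀ t, R t ≤ P)
    (hqP : ∀ᵐ x ∂(volume.restrict Ω), (q x).toReal ≤ P)
    (hqU : ∀ t, ∀ᵐ x ∂(volume.restrict Ω), x ∈ U t → r t ≤ (q x).toReal ∧ (q x).toReal ≤ R t)
    {L C : ℝ≥0} (hL : ∀ t, (volume.restrict Ω (U t))⁻¹ ^ (R t - r t) ≤ L) (hC1 : 1 ≤ C)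
    (hC : ∀ᵐ x ∂(volume.restrict Ω), ∑' t, (U t).indicator (fun _ => (1 : ℝ≥0∞)) x ≤ C) :
    ∃ C' : ℝ≥0, ∀ f : EuclideanSpace ℝ (Fin n) → ℝ≥0∞, AEMeasurable f (volume.restrict Ω) →
      ∫⁻ x in Ω, f x ^ (q x).toReal ≤ 1 →
      ∫⁻ x in Ω, (∑' t, (U t).indicator (fun _ => luxNorm Ω q ((U t).indicator f) /
        luxNorm Ω q ((U t).indicator fun _ => 1)) x) ^ (q x).toReal ≤ C' := by
  set μ := volume.restrict Ω with hμ
  rcases isEmpty_or_nonempty Γ with hemp | ⟨⟨t₀⟩⟩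
  · refine ⟨0, fun f _ _ => le_of_eq ?_⟩
    simp only [tsum_empty]
    rw [lintegral_eq_zero_of_ae_eq_zero, ENNReal.coe_zero]
    filter_upwards [hq1] with x hx
    simp [show 0 < (q x).toReal by linarith]
  have hP0 : 0 ≤ P := by linarith [hr t₀, hrR t₀, hRP t₀]
  set B : ℝ≥0∞ := C ^ P * (2 ^ P * (C * volume Ω + 2 ^ P * L * (C * 1))) with hB
  have hBt : B ≠ ∞ := by
    have h1 : (C : ℝ≥0∞) ^ P ≠ ∞ := ENNReal.rpow_ne_top_of_nonneg hP0 ENNReal.coe_ne_top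
    have h2 : (2 : ℝ≥0∞) ^ P ≠ ∞ := ENNReal.rpow_ne_top_of_nonneg hP0 (by simp)
    finiteness
  refine ⟨B.toNNReal, fun f hf hf1 => ?_⟩
  rw [ENNReal.coe_toNNReal hBt]
  have hqm' : AEMeasurable (fun x => (q x).toReal) μ := hqm.ennreal_toReal
  set a : Γ → ℝ≥0∞ := fun t => luxNorm Ω q ((U t).indicator f) /
        luxNorm Ω q ((U t).indicator fun _ => 1) with ha
  calc ∫⁻ x, (∑' t, (U t).indicator (fun _ => a t) x) ^ (q x).toReal ∂μ
      ≤ ∫⁻ x, (C : ℝ≥0∞) ^ P *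
          ∑' t, (U t).indicator (fun x => a t ^ (q x).toReal) x ∂μ := by
        refine lintegral_mono_ae ?_
        filter_upwards [hq1, hqP, hC] with x h1 h2 h3
        refine (tsum_indicator_rpow_le (by exact_mod_cast hC1) h3 a h1 h2).trans (le_of_eq ?_)
        congr 1
    _ = (C : ℝ≥0∞) ^ P * ∑' t, ∫⁻ x in U t, a t ^ (q x).toReal ∂μ := by
        rw [lintegral_const_mul' _ _ (ENNReal.rpow_ne_top_of_nonneg hP0 ENNReal.coe_ne_top),
          lintegral_tsum fun t => (aemeasurable_const.pow hqm').indicator (hU t)]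
        simp only [lintegral_indicator (hU _)]
    _ ≤ (C : ℝ≥0∞) ^ P * ∑' t, 2 ^ P * (μ (U t) +
          2 ^ P * L * ∫⁻ x in U t, f x ^ (q x).toReal ∂μ) := by
        gcongr with t
        exact setLIntegral_luxNorm_div_rpow_le hΩ hfin hq1 (hU t) (hU0 t) (hr t) (hrR t) (hRP t)
          (hqU t) (hL t) hf1
    _ = (C : ℝ≥0∞) ^ P * (2 ^ P * (∑' t, μ (U t) +
          2 ^ P * L * ∑' t, ∫⁻ x in U t, f x ^ (q x).toReal ∂μ)) := by
        rw [ENNReal.tsum_mul_left, ENNReal.tsum_add, ENNReal.tsum_mul_left]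
    _ ≤ B := by
        rw [hB]
        gcongr _ * (_ * (?_ + _ * ?_))
        · have := tsum_setLIntegral_le_of_overlap (μ := μ) hU hC (f := fun _ => 1)
            aemeasurable_const
          simpa [hμ] using this
        · refine (tsum_setLIntegral_le_of_overlap hU hC (hf.pow hqm')).trans ?_
          gcongr

end Luxemburg

/-! ### Geometry of Whitney cubes -/

theorem abs_sub_apply_le_dist {n : ℕ} (x y : EuclideanSpace ℝ (Fin n)) (i : Fin n) :
    |x i - y i| ≤ dist x y := by
  rw [dist_eq_norm]
  exact PiLp.norm_apply_le (x - y) i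

theorem dist_le_sqrt_mul {n : ℕ} {x y : EuclideanSpace ℝ (Fin n)} {h : ℝ} (hh : 0 ≤ h)
    (hxy : ∀ i, |x i - y i| ≤ h) : dist x y ≤ √n * h := by
  rw [EuclideanSpace.dist_eq]
  calc √(∑ i, dist (x i) (y i) ^ 2) ≤ √(∑ _i : Fin n, h ^ 2) := by
        gcongr with i
        exact hxy i
    _ = √n * h := by
        rw [Finset.sum_const, Finset.card_univ, Fintype.card_fin, nsmul_eq_mul,
          Real.sqrt_mul (by positivity), Real.sqrt_sq hh]

namespace DyadicCube

variable {n : ℕ} (Q : DyadicCube n)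

theorem side_pos : 0 < Q.side := by
  unfold side; positivity

theorem carrier_eq_dilate : Q.carrier = Q.dilate 1 := by
  ext x
  simp only [carrier, dilate, center, mem_ofPred_eq]
  refine forall_congr' fun i => ?_
  rw [abs_le]
  constructor <;> rintro ⟨h1, h2⟩ <;> constructor <;> linarith

theorem openDilate_subset_openDilate {c c' : ℝ} (h : c ≤ c') :
    Q.openDilate c ⊆ Q.openDilate c' := by
  intro x hx i
  have := Q.side_pos
  exact (hx i).trans_le (by gcongr)

theorem openDilate_one_subset_carrier : Q.openDilate 1 ⊆ Q.carrier := by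
  rw [carrier_eq_dilate]
  exact fun x hx i => (hx i).le

theorem carrier_subset_openDilate {c : ℝ} (hc : 1 < c) : Q.carrier ⊆ Q.openDilate c := by
  rw [carrier_eq_dilate]
  have := Q.side_pos
  exact fun x hx i => (hx i).trans_lt (by gcongr)

theorem center_mem_openDilate {c : ℝ} (hc : 0 < c) : Q.center ∈ Q.openDilate c := by
  intro i
  have := Q.side_pos
  rw [sub_self, abs_zero]
  positivity

theorem isOpen_openDilate (c : ℝ) : IsOpen (Q.openDilate c) := by
  rw [openDilate, ofPred_forall]
  exact isOpen_iInter_of_finite fun i => isOpen_lt (by fun_prop) continuous_const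

theorem isClosed_dilate (c : ℝ) : IsClosed (Q.dilate c) := by
  rw [dilate, ofPred_forall]
  exact isClosed_iInter fun i => isClosed_le (by fun_prop) continuous_const

theorem isClosed_carrier : IsClosed Q.carrier := by
  rw [carrier_eq_dilate]; exact Q.isClosed_dilate 1

theorem volume_openDilate (c : ℝ) : volume (Q.openDilate c) = ENNReal.ofReal (c * Q.side) ^ n := by
  have h : Q.openDilate c = (MeasurableEquiv.toLp 2 (Fin n → ℝ)).symm ⁻¹'
      (univ.pi fun i => Ioo (Q.center i - c * Q.side / 2) (Q.center i + c * Q.side / 2)) := by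
    ext x
    simp only [openDilate, mem_ofPred_eq, mem_preimage, mem_univ_pi, mem_Ioo]
    refine forall_congr' fun i => ?_
    change _ ↔ _ < x i ∧ x i < _
    rw [abs_lt]
    constructor <;> rintro ⟨h1, h2⟩ <;> constructor <;> linarith
  rw [h, (EuclideanSpace.volume_preserving_symm_measurableEquiv_toLp (Fin n)).measure_preimage_equiv,
    Real.volume_pi_Ioo]
  simp only [show ∀ i, Q.center i + c * Q.side / 2 - (Q.center i - c * Q.side / 2) = c * Q.side
    from fun i => by ring]
  simp

theorem volume_dilate (c : ℝ) : volume (Q.dilate c) = ENNReal.ofReal (c * Q.side) ^ n := by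
  have h : Q.dilate c = (MeasurableEquiv.toLp 2 (Fin n → ℝ)).symm ⁻¹'
      (Icc (fun i => Q.center i - c * Q.side / 2) (fun i => Q.center i + c * Q.side / 2)) := by
    ext x
    simp only [dilate, mem_ofPred_eq, mem_preimage, mem_Icc, Pi.le_def, ← forall_and]
    refine forall_congr' fun i => ?_
    change _ ↔ _ ≤ x i ∧ x i ≤ _
    rw [abs_le]
    constructor <;> rintro ⟨h1, h2⟩ <;> constructor <;> linarith
  rw [h, (EuclideanSpace.volume_preserving_symm_measurableEquiv_toLp (Fin n)).measure_preimage_equiv,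
    Real.volume_Icc_pi]
  simp only [show ∀ i, Q.center i + c * Q.side / 2 - (Q.center i - c * Q.side / 2) = c * Q.side
    from fun i => by ring]
  simp

theorem volume_openDilate_ne_zero {c : ℝ} (hc : 0 < c) : volume (Q.openDilate c) ≠ 0 :=
  (Q.isOpen_openDilate c).measure_ne_zero volume ⟨_, Q.center_mem_openDilate hc⟩

theorem volume_carrier_diff : volume (Q.carrier \ Q.openDilate 1) = 0 := by
  rw [measure_sdiff Q.openDilate_one_subset_carrier
    (Q.isOpen_openDilate 1).measurableSet.nullMeasurableSet, carrier_eq_dilate, volume_dilate,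
    volume_openDilate, tsub_self]
  rw [volume_openDilate]
  finiteness

theorem abs_sub_apply_le_of_mem {x y : EuclideanSpace ℝ (Fin n)} (hx : x ∈ Q.carrier)
    (hy : y ∈ Q.carrier) (i : Fin n) : |x i - y i| ≤ Q.side := by
  rw [abs_le]
  constructor <;> linarith [(hx i).1, (hx i).2, (hy i).1, (hy i).2]

theorem dist_le_of_mem {x y : EuclideanSpace ℝ (Fin n)} (hx : x ∈ Q.carrier) (hy : y ∈ Q.carrier) :
    dist x y ≤ √n * Q.side :=
  dist_le_sqrt_mul Q.side_pos.le (Q.abs_sub_apply_le_of_mem hx hy)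

theorem isBounded_carrier : Bornology.IsBounded Q.carrier :=
  Metric.isBounded_iff.2 ⟨_, fun _ hx _ hy => Q.dist_le_of_mem hx hy⟩

theorem diam_le : Metric.diam Q.carrier ≤ √n * Q.side :=
  Metric.diam_le_of_forall_dist_le (by have := Q.side_pos; positivity)
    fun _ hx _ hy => Q.dist_le_of_mem hx hy

/-- The corner of the cube whose coordinates are smallest. -/
noncomputable def lowerCorner : EuclideanSpace ℝ (Fin n) :=
  WithLp.toLp 2 fun i => (Q.corner i : ℝ) * Q.side

/-- The corner of the cube whose coordinates are largest. -/
noncomputable def upperCorner : EuclideanSpace ℝ (Fin n) :=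
  WithLp.toLp 2 fun i => ((Q.corner i : ℝ) + 1) * Q.side

theorem lowerCorner_mem : Q.lowerCorner ∈ Q.carrier := by
  intro i
  have := Q.side_pos
  simp only [lowerCorner]
  constructor <;> linarith

theorem upperCorner_mem : Q.upperCorner ∈ Q.carrier := by
  intro i
  have := Q.side_pos
  simp only [upperCorner]
  constructor <;> linarith

theorem upperCorner_sub_lowerCorner (i : Fin n) : Q.upperCorner i - Q.lowerCorner i = Q.side := by
  simp only [upperCorner, lowerCorner]; ring

theorem center_mem_carrier : Q.center ∈ Q.carrier :=
  Q.openDilate_one_subset_carrier (Q.center_mem_openDilate one_pos)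

theorem side_le_diam (hn : 1 ≤ n) : Q.side ≤ Metric.diam Q.carrier := by
  refine le_trans ?_ (Metric.dist_le_diam_of_mem Q.isBounded_carrier Q.upperCorner_mem
    Q.lowerCorner_mem)
  refine le_trans ?_ (abs_sub_apply_le_dist _ _ ⟨0, hn⟩)
  rw [upperCorner_sub_lowerCorner]
  exact le_abs_self _

theorem side_le_of_carrier_subset_dilate (hn : 1 ≤ n) {R : DyadicCube n} {K : ℝ}
    (h : Q.carrier ⊆ R.dilate K) : Q.side ≤ K * R.side := by
  have h1 := abs_le.1 (h Q.upperCorner_mem ⟨0, hn⟩)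
  have h2 := abs_le.1 (h Q.lowerCorner_mem ⟨0, hn⟩)
  have h3 := Q.upperCorner_sub_lowerCorner ⟨0, hn⟩
  linarith

end DyadicCube

theorem setDist_le_dist {n : ℕ} {A B : Set (EuclideanSpace ℝ (Fin n))}
    {x y : EuclideanSpace ℝ (Fin n)} (hx : x ∈ A) (hy : y ∈ B) : setDist A B ≤ dist x y := by
  refine csInf_le ⟨0, ?_⟩ ⟨x, hx, y, hy, rfl⟩
  rintro _ ⟨x, -, y, -, rfl⟩
  exact dist_nonneg

/-! ### Size and position of the cubes of a Whitney decomposition. -/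

namespace IsWhitneyDecomposition

variable {n : ℕ} {Ω : Set (EuclideanSpace ℝ (Fin n))} {Γ : Type u} {Q : Γ → DyadicCube n}

theorem frontier_nonempty (h : IsWhitneyDecomposition Ω Q) (hn : 1 ≤ n) (t : Γ) :
    (frontier Ω).Nonempty := by
  by_contra hne
  rw [not_nonempty_iff_eq_empty] at hne
  have h1 := h.diam_le t
  -- With an empty boundary `setDist` takes the default value 0, which the positive diameter of a
  -- cube contradicts.
  rw [hne, setDist, image2_empty_right, Real.sInf_empty] at h1
  linarith [(Q t).side_le_diam hn, (Q t).side_pos]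

theorem side_le_bdist (h : IsWhitneyDecomposition Ω Q) (hn : 1 ≤ n) (t : Γ) :
    (Q t).side ≤ bdist Ω (Q t).center := by
  rw [bdist, Metric.le_infDist (h.frontier_nonempty hn t)]
  intro y hy
  exact ((Q t).side_le_diam hn).trans
    ((h.diam_le t).trans (setDist_le_dist (Q t).center_mem_carrier hy))

theorem bdist_le_side (h : IsWhitneyDecomposition Ω Q) (hn : 1 ≤ n) (t : Γ) :
    bdist Ω (Q t).center ≤ 5 * √n * (Q t).side := by
  have h1 : bdist Ω (Q t).center - √n * (Q t).side ≤ setDist (Q t).carrier (frontier Ω) := by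
    obtain ⟨y, hy⟩ := h.frontier_nonempty hn t
    refine le_csInf ⟨_, (Q t).center, (Q t).center_mem_carrier, y, hy, rfl⟩ ?_
    rintro _ ⟨x, hx, y, hy, rfl⟩
    have h2 : bdist Ω (Q t).center ≤ dist (Q t).center y := Metric.infDist_le_dist_of_mem hy
    linarith [dist_triangle (Q t).center x y, (Q t).dist_le_of_mem (Q t).center_mem_carrier hx]
  linarith [h.le_diam t, (Q t).diam_le]

theorem carrier_subset (h : IsWhitneyDecomposition Ω Q) (t : Γ) : (Q t).carrier ⊆ Ω := by
  rw [← h.iUnion_eq]; exact subset_iUnion (fun t => (Q t).carrier) t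

theorem pairwise_disjoint_openDilate (h : IsWhitneyDecomposition Ω Q) :
    Pairwise (Function.onFun Disjoint fun t => (Q t).openDilate 1) := fun s t hst =>
  (h.disjoint_interior s t hst).mono
    (interior_maximal (Q s).openDilate_one_subset_carrier ((Q s).isOpen_openDilate 1))
    (interior_maximal (Q t).openDilate_one_subset_carrier ((Q t).isOpen_openDilate 1))

theorem countable (h : IsWhitneyDecomposition Ω Q) : Countable Γ := by
  rw [← countable_univ_iff]
  exact PairwiseDisjoint.countable_of_isOpen (s := fun t => (Q t).openDilate 1)
    (fun s _ t _ hst => h.pairwise_disjoint_openDilate hst)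
    (fun t _ => (Q t).isOpen_openDilate 1)
    (fun t _ => ⟨_, (Q t).center_mem_openDilate one_pos⟩)

theorem ae_mem_iUnion_openDilate (h : IsWhitneyDecomposition Ω Q) :
    ∀ᵐ x, x ∈ Ω → x ∈ ⋃ t, (Q t).openDilate 1 := by
  have := h.countable
  have h0 : ∀ᵐ x, ∀ t, x ∉ (Q t).carrier \ (Q t).openDilate 1 :=
    ae_all_iff.2 fun t => measure_eq_zero_iff_ae_notMem.1 (Q t).volume_carrier_diff
  filter_upwards [h0] with x hx hxΩ
  rw [← h.iUnion_eq] at hxΩ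
  obtain ⟨t, ht⟩ := mem_iUnion.1 hxΩ
  refine mem_iUnion.2 ⟨t, ?_⟩
  by_contra hxt
  exact hx t ⟨ht, hxt⟩

end IsWhitneyDecomposition

/-! ### Shadows, volumes and degrees in a `K`-tree-covering. -/

namespace IsJohnTreeCovering

variable {n : ℕ} {Ω : Set (EuclideanSpace ℝ (Fin n))} {Γ : Type u} {Q : Γ → DyadicCube n}
  {G : SimpleGraph Γ} {a : Γ} {K : ℝ}

/-- A point of `U_s`, `s ⪰ t`, is coordinatewise within `(17/32) K` sides of `Q t` from the center
of `Q s`, which is itself within `K / 2` sides from that of `Q t`; hence the generous `2K`. The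
added 1 gives the strict inequality and `τ ≥ 1`. The side is at most `d(x_t)`. -/
theorem isShadowConstant (h : IsJohnTreeCovering Ω Q G a K) (hn : 1 ≤ n) (hK : 1 < K) :
    IsShadowConstant Ω Q G a (2 * K * √n + 1) := by
  refine ⟨le_add_of_nonneg_left (by positivity), fun t x hx => ?_⟩
  simp only [shadow, mem_iUnion] at hx
  obtain ⟨s, hs, hxs⟩ := hx
  have hsub := h.subset_dilate s t hs
  have hside := (Q s).side_le_of_carrier_subset_dilate hn hsub
  have ht := (Q t).side_pos
  have hd : dist x (Q t).center ≤ √n * (2 * K * (Q t).side) := by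
    refine dist_le_sqrt_mul (by positivity) fun i => ?_
    have h1 := abs_lt.1 (hxs i)
    have h2 := abs_le.1 (hsub (Q s).center_mem_carrier i)
    have h3 : 0 < K * (Q t).side := by positivity
    rw [abs_le]
    constructor <;> linarith
  rw [bball, Metric.mem_ball]
  calc dist x (Q t).center ≤ 2 * K * √n * (Q t).side := by linarith
    _ < (2 * K * √n + 1) * (Q t).side := by gcongr; linarith
    _ ≤ _ := by gcongr; exact h.whitney.side_le_bdist hn t

/-- The interiors of the cubes above `t` are disjoint and all lie in `K Q t`, a cube of volume `Kⁿ
|Q t|`. -/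
theorem tsum_volume_le (h : IsJohnTreeCovering Ω Q G a K) (hK : 1 < K) (t : Γ) :
    ∑' s, {s | TreeLE G a t s}.indicator (fun s => volume ((Q s).openDilate 1)) s ≤
      (K.toNNReal ^ n : ℝ≥0) * volume ((Q t).openDilate 1) := by
  have := h.whitney.countable
  calc ∑' s, {s | TreeLE G a t s}.indicator (fun s => volume ((Q s).openDilate 1)) s
      = volume (⋃ s : {s | TreeLE G a t s}, (Q s).openDilate 1) := by
        rw [← tsum_subtype, measure_iUnion]
        · exact fun i j hij => h.whitney.pairwise_disjoint_openDilate fun he => hij (Subtype.ext he)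
        · exact fun i => ((Q i).isOpen_openDilate 1).measurableSet
    _ ≤ volume ((Q t).dilate K) :=
        measure_mono (iUnion_subset fun s =>
          (Q s).openDilate_one_subset_carrier.trans (h.subset_dilate s t s.2))
    _ = _ := by
        rw [DyadicCube.volume_dilate, DyadicCube.volume_openDilate, one_mul,
          ENNReal.ofReal_mul (by linarith), mul_pow, ENNReal.coe_pow]
        rfl

/-- Adjacent cubes meet, so they have comparable sizes; the disjoint pieces `B s` of the children
therefore have volumes bounded below, and all fit inside `U_t`. Finiteness makes the sum over
children finite and its support closed. -/
theorem finite_children (h : IsJohnTreeCovering Ω Q G a K) (hn : 1 ≤ n) (t : Γ) :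
    {s | IsParent G a t s}.Finite := by
  obtain ⟨B, C₂, hBo, hBd, hBU, hBv⟩ := h.treeCovering.exists_pieces
  have hroot : ∀ s : {s | IsParent G a t s}, (s : Γ) ≠ a := by
    intro s hs
    have := ((isParent_iff h.treeCovering.isTree).1 s.2).2
    rw [hs, SimpleGraph.dist_self] at this
    omega
  have hn0 : 0 < √(n : ℝ) := Real.sqrt_pos.2 (by exact_mod_cast hn)
  set ρ : ℝ := (Q t).side / (4 * √n) with hρ
  have hρ0 : 0 < ρ := by have := (Q t).side_pos; positivity
  have hside : ∀ s : {s | IsParent G a t s}, ρ ≤ (Q s).side := by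
    intro s
    have h1 := (h.whitney.comparable s t (h.face s t s.2.1.symm).1).2
    rw [hρ, div_le_iff₀ (by positivity)]
    linarith [(Q t).side_le_diam hn, (Q (s : Γ)).diam_le]
  -- `C₂ + 1` in the denominator excludes division by zero.
  have hε0 : 0 < ENNReal.ofReal ρ ^ n / (C₂ + 1) :=
    ENNReal.div_pos (pow_ne_zero _ (by simpa using hρ0)) (by finiteness)
  have hfin := Measure.finite_const_le_meas_of_disjoint_iUnion volume hε0
    (As := fun s : {s | IsParent G a t s} => B s) (fun s => (hBo s (hroot s)).measurableSet)
    (fun s r hsr => hBd s r (hroot s) (hroot r) fun he => hsr (Subtype.ext he))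
    (ne_top_of_le_ne_top (b := volume (expanded Q t))
      (by rw [expanded, DyadicCube.volume_openDilate]; finiteness)
      (measure_mono (iUnion_subset fun s =>
        (hBU s t (hroot s) s.2).trans inter_subset_right)))
  rw [← finite_coe_iff, ← finite_univ_iff]
  refine hfin.subset fun s _ => ?_
  change _ ≤ volume (B s)
  refine ENNReal.div_le_of_le_mul' ?_
  calc ENNReal.ofReal ρ ^ n ≤ ENNReal.ofReal (17 / 16 * (Q s).side) ^ n := by
        gcongr
        linarith [hside s, (Q (s : Γ)).side_pos]
    _ = volume (expanded Q s) := by rw [expanded, DyadicCube.volume_openDilate]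
    _ ≤ C₂ * volume (B s) := hBv s (hroot s)
    _ ≤ (C₂ + 1) * volume (B s) := by gcongr; exact le_self_add

end IsJohnTreeCovering

/-! ### Oscillation of the exponent near Whitney cubes -/

section Exponent

variable {n : ℕ} {Ω : Set (EuclideanSpace ℝ (Fin n))} {q : EuclideanSpace ℝ (Fin n) → ℝ≥0∞}

theorem expMinus_mono {A B : Set (EuclideanSpace ℝ (Fin n))} (h : A ⊆ B) :
    expMinus q B ≤ expMinus q A :=
  essInf_antitone_measure (Measure.absolutelyContinuous_of_le (Measure.restrict_mono_set _ h))

theorem expPlus_mono {A B : Set (EuclideanSpace ℝ (Fin n))} (h : A ⊆ B) :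
    expPlus q A ≤ expPlus q B :=
  essSup_mono_measure (Measure.absolutelyContinuous_of_le (Measure.restrict_mono_set _ h))

theorem ae_expMinus_le (A : Set (EuclideanSpace ℝ (Fin n))) :
    ∀ᵐ x ∂(volume.restrict A), expMinus q A ≤ q x := ae_essInf_le

theorem ae_le_expPlus (A : Set (EuclideanSpace ℝ (Fin n))) :
    ∀ᵐ x ∂(volume.restrict A), q x ≤ expPlus q A := ENNReal.ae_le_essSup q

theorem expMinus_le_expPlus {A : Set (EuclideanSpace ℝ (Fin n))} (h : volume A ≠ 0) :
    expMinus q A ≤ expPlus q A := by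
  have : NeZero (volume.restrict A) := ⟨by simpa using h⟩
  obtain ⟨x, h1, h2⟩ := ((ae_expMinus_le (q := q) A).and (ae_le_expPlus (q := q) A)).exists
  exact h1.trans h2

/-- Logarithmic form of `(σ ^ N)⁻¹ ^ δ ≤ const`, for a cube of side `σ` at distance about `d` from
the boundary. If `τ * d ≤ 1 / 2`, the log-Hölder bound applies, and `-log σ` exceeds `-log (τ * d)`
by at most `log (2 * κ * τ)`. Otherwise `σ` is bounded below by `1 / (2 * κ * τ)`, and `δ ≤ P` is
enough. -/
theorem neg_mul_log_le {N σ d τ κ δ P C₀ : ℝ} (hN : 0 ≤ N) (hd : 0 < d) (hτ : 1 ≤ τ)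
    (hκ : 1 ≤ κ) (hdσ : d ≤ κ * σ) (hδ : 0 ≤ δ) (hδP : δ ≤ P) (hC₀ : 0 ≤ C₀)
    (h : τ * d ≤ 1 / 2 → δ ≤ C₀ / -Real.log (τ * d)) :
    -(N * δ) * Real.log σ ≤ N * P * Real.log (2 * κ * τ) + N * C₀ := by
  have hσ : 0 < σ := by by_contra! hσ; nlinarith
  have hlog2 : 0 ≤ Real.log (2 * κ * τ) := Real.log_nonneg (by nlinarith)
  have hlog1 : Real.log (κ * τ) ≤ Real.log (2 * κ * τ) :=
    Real.log_le_log (by positivity) (by nlinarith [mul_pos (one_pos.trans_le hκ) (one_pos.trans_le hτ)])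
  rcases le_or_gt (τ * d) (1 / 2) with hcase | hcase
  · have hneg : 0 < -Real.log (τ * d) := by
      rw [neg_pos]
      exact Real.log_neg (by positivity) (by linarith)
    have h1 : δ * -Real.log (τ * d) ≤ C₀ := (le_div_iff₀ hneg).1 (h hcase)
    have h2 : Real.log (τ * d) ≤ Real.log (2 * κ * τ) + Real.log σ := by
      refine le_trans ?_ (add_le_add_left hlog1 _)
      rw [← Real.log_mul (by positivity) hσ.ne']
      refine Real.log_le_log (by positivity) ?_
      nlinarith
    have h3 : δ * -Real.log σ ≤ P * Real.log (2 * κ * τ) + C₀ := by nlinarith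
    nlinarith
  · have h2 : 0 ≤ Real.log (2 * κ * τ) + Real.log σ := by
      rw [← Real.log_mul (by positivity) hσ.ne']
      refine Real.log_nonneg ?_
      nlinarith
    have h3 : δ * -Real.log σ ≤ P * Real.log (2 * κ * τ) := by nlinarith
    nlinarith [mul_nonneg hN hC₀]

/-- The local bounds for the exponent that follow from the boundary log-Hölder condition. -/
theorem exists_exponent_bounds {Γ : Type u} {Q : Γ → DyadicCube n} (hn : 1 ≤ n) (hΩ : IsOpen Ω)
    (hQ : IsWhitneyDecomposition Ω Q) {τ : ℝ} (hτ : 1 ≤ τ)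
    (hLH : BoundaryLogHolder Ω τ q) (hq1 : 1 < expMinus q Ω) (hqt : expPlus q Ω < ∞)
    (hΩ0 : volume Ω ≠ 0) :
    ∃ (p P : ℝ) (r R : Γ → ℝ) (L : ℝ≥0), 1 < p ∧ (∀ t, p ≤ r t) ∧ (∀ t, r t ≤ R t) ∧
      (∀ t, R t ≤ P) ∧
      (∀ᵐ x ∂(volume.restrict Ω), q x ≠ ∞ ∧ p ≤ (q x).toReal ∧ (q x).toReal ≤ P) ∧
      (∀ t, ∀ᵐ x ∂(volume.restrict Ω), x ∈ bball Ω τ (Q t).center →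
        r t ≤ (q x).toReal ∧ (q x).toReal ≤ R t) ∧
      ∀ t, (volume ((Q t).openDilate 1))⁻¹ ^ (R t - r t) ≤ L := by
  obtain ⟨C₀, hC₀, hLH⟩ := hLH
  have hPt : expPlus q Ω ≠ ∞ := hqt.ne
  have hpt : expMinus q Ω ≠ ∞ := ne_top_of_le_ne_top hPt (expMinus_le_expPlus hΩ0)
  set A : Γ → Set (EuclideanSpace ℝ (Fin n)) := fun t => bball Ω τ (Q t).center ∩ Ω with hA
  have hAΩ : ∀ t, A t ⊆ Ω := fun t => inter_subset_right
  have hd : ∀ t, 0 < bdist Ω (Q t).center := fun t =>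
    (Q t).side_pos.trans_le (hQ.side_le_bdist hn t)
  have hcΩ : ∀ t, (Q t).center ∈ Ω := fun t => hQ.carrier_subset t (Q t).center_mem_carrier
  have hAo : ∀ t, IsOpen (A t) := fun t => Metric.isOpen_ball.inter hΩ
  have hA0 : ∀ t, volume (A t) ≠ 0 := fun t =>
    (hAo t).measure_ne_zero volume
      ⟨_, Metric.mem_ball_self (mul_pos (one_pos.trans_le hτ) (hd t)), hcΩ t⟩
  have hRt : ∀ t, expPlus q (A t) ≠ ∞ := fun t => ne_top_of_le_ne_top hPt (expPlus_mono (hAΩ t))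
  have hrt : ∀ t, expMinus q (A t) ≠ ∞ := fun t =>
    ne_top_of_le_ne_top (hRt t) (expMinus_le_expPlus (hA0 t))
  have hpr : ∀ t, (expMinus q Ω).toReal ≤ (expMinus q (A t)).toReal := fun t =>
    ENNReal.toReal_mono (hrt t) (expMinus_mono (hAΩ t))
  have hrR : ∀ t, (expMinus q (A t)).toReal ≤ (expPlus q (A t)).toReal := fun t =>
    ENNReal.toReal_mono (hRt t) (expMinus_le_expPlus (hA0 t))
  have hRP : ∀ t, (expPlus q (A t)).toReal ≤ (expPlus q Ω).toReal := fun t =>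
    ENNReal.toReal_mono hPt (expPlus_mono (hAΩ t))
  have hp1 : 1 < (expMinus q Ω).toReal := by
    rw [← ENNReal.toReal_one]; exact ENNReal.toReal_strict_mono hpt hq1
  have hqae : ∀ᵐ x ∂(volume.restrict Ω), q x ≠ ∞ := by
    filter_upwards [ae_le_expPlus (q := q) Ω] with x hx using ne_top_of_le_ne_top hPt hx
  set N : ℝ := (n : ℝ) with hN
  set κ : ℝ := 5 * √n with hκ
  have hκ1 : 1 ≤ κ := by
    have : 1 ≤ √(n : ℝ) := Real.one_le_sqrt.2 (by exact_mod_cast hn)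
    linarith
  set ℓ : ℝ := N * (expPlus q Ω).toReal * Real.log (2 * κ * τ) + N * C₀ with hℓ
  refine ⟨(expMinus q Ω).toReal, (expPlus q Ω).toReal, fun t => (expMinus q (A t)).toReal,
    fun t => (expPlus q (A t)).toReal, (Real.exp ℓ).toNNReal, hp1, hpr, hrR, hRP, ?_, ?_, ?_⟩
  · filter_upwards [ae_le_expPlus (q := q) Ω, ae_expMinus_le (q := q) Ω, hqae] with x h1 h2 h3
    exact ⟨h3, ENNReal.toReal_mono h3 h2, ENNReal.toReal_mono hPt h1⟩
  · intro t
    have h1 := (ae_restrict_iff' (hAo t).measurableSet).1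
      ((ae_le_expPlus (q := q) (A t)).and (ae_expMinus_le (q := q) (A t)))
    rw [ae_restrict_iff' hΩ.measurableSet] at hqae ⊢
    filter_upwards [h1, hqae] with x h1 h3 hxΩ hx
    obtain ⟨h4, h5⟩ := h1 ⟨hx, hxΩ⟩
    exact ⟨ENNReal.toReal_mono (h3 hxΩ) h5, ENNReal.toReal_mono (hRt t) h4⟩
  · intro t
    have hσ := (Q t).side_pos
    set δ : ℝ := (expPlus q (A t)).toReal - (expMinus q (A t)).toReal with hδ
    have hδ0 : 0 ≤ δ := sub_nonneg.2 (hrR t)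
    have key : -(N * δ) * Real.log (Q t).side ≤ ℓ := by
      refine neg_mul_log_le (by positivity) (hd t) hτ hκ1 (hQ.bdist_le_side hn t) hδ0 ?_ hC₀ ?_
      · have : 0 ≤ (expMinus q (A t)).toReal := ENNReal.toReal_nonneg
        linarith [hRP t]
      · intro hsmall
        have h1 := hLH _ (hcΩ t) hsmall
        have hlog : 0 ≤ C₀ / -Real.log (τ * bdist Ω (Q t).center) := by
          refine div_nonneg hC₀ (neg_nonneg.2 (Real.log_nonpos ?_ (by linarith)))
          exact (mul_pos (one_pos.trans_le hτ) (hd t)).le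
        have h2 := ENNReal.toReal_mono (by finiteness [hrt t]) h1
        rw [ENNReal.toReal_add (hrt t) ENNReal.ofReal_ne_top, ENNReal.toReal_ofReal hlog] at h2
        linarith
    rw [DyadicCube.volume_openDilate, one_mul, ← ENNReal.ofReal_pow hσ.le,
      ← ENNReal.ofReal_inv_of_pos (by positivity),
      ENNReal.ofReal_rpow_of_pos (by positivity)]
    refine ENNReal.ofReal_le_ofReal ?_
    rw [Real.rpow_def_of_pos (by positivity), Real.log_inv, Real.log_pow]
    exact Real.exp_le_exp.2 (by linarith)

end Exponent

/-! ### The decomposition along the tree -/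

section Shadows

variable {X : Type*} {Γ : Type u} {le : Γ → Γ → Prop} {dep : Γ → ℕ} {D : Γ → Set X}

/-- The union of the sets indexed by the vertices above `t`. -/
def upperUnion (le : Γ → Γ → Prop) (D : Γ → Set X) (t : Γ) : Set X := ⋃ s : {s | le t s}, D s

theorem mem_upperUnion {t : Γ} {x : X} : x ∈ upperUnion le D t ↔ ∃ s, le t s ∧ x ∈ D s := by
  simp [upperUnion]

namespace IsTreeOrder

theorem upperUnion_eq (h : IsTreeOrder le dep) {t : Γ} {F : Finset Γ}
    (hF : ∀ s, s ∈ F ↔ le t s ∧ dep s = dep t + 1) :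
    upperUnion le D t = D t ∪ ⋃ s ∈ F, upperUnion le D s := by
  ext x
  simp only [mem_union, mem_iUnion, mem_upperUnion, hF]
  constructor
  · rintro ⟨u, hu, hx⟩
    rcases eq_or_ne t u with rfl | hne
    · exact Or.inl hx
    · have h1 : dep t ≠ dep u := fun he => hne (h.inj hu (h.refl u) he)
      obtain ⟨s, hs, hsu, hd⟩ := h.exists_between 1 hu (by have := h.dep_le hu; omega)
      exact Or.inr ⟨s, ⟨hs, hd⟩, u, hsu, hx⟩
  · rintro (hx | ⟨s, ⟨hs, -⟩, u, hu, hx⟩)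
    · exact ⟨t, h.refl t, hx⟩
    · exact ⟨u, h.trans hs hu, hx⟩

theorem disjoint_upperUnion (h : IsTreeOrder le dep)
    (hD : Pairwise (Function.onFun Disjoint D)) {s t : Γ}
    (hst : dep s = dep t) (hne : s ≠ t) : Disjoint (upperUnion le D s) (upperUnion le D t) := by
  rw [disjoint_left]
  intro x hxs hxt
  obtain ⟨u, hu, hxu⟩ := mem_upperUnion.1 hxs
  obtain ⟨v, hv, hxv⟩ := mem_upperUnion.1 hxt
  obtain rfl : u = v := by
    by_contra huv
    exact disjoint_left.1 (hD huv) hxu hxv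
  exact hne (h.inj hu hv hst)

theorem disjoint_upperUnion_of_lt (h : IsTreeOrder le dep)
    (hD : Pairwise (Function.onFun Disjoint D)) {s t : Γ}
    (hst : dep t < dep s) : Disjoint (D t) (upperUnion le D s) := by
  rw [disjoint_left]
  intro x hxt hxs
  obtain ⟨u, hu, hxu⟩ := mem_upperUnion.1 hxs
  obtain rfl : t = u := by
    by_contra htu
    exact disjoint_left.1 (hD htu) hxt hxu
  exact absurd (h.dep_le hu) (by omega)

/-- Two vertices of equal depth have no common descendant, so `upperUnion` at `t` splits disjointly
into `D t` and the unions at the children. -/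
theorem setIntegral_upperUnion (h : IsTreeOrder le dep) [MeasurableSpace X] {μ : Measure X}
    [Countable Γ] (hDm : ∀ t, MeasurableSet (D t)) (hD : Pairwise (Function.onFun Disjoint D)) {t : Γ}
    {F : Finset Γ} (hF : ∀ s, s ∈ F ↔ le t s ∧ dep s = dep t + 1) {g : X → ℝ}
    (hg : Integrable g μ) :
    ∫ x in upperUnion le D t, g x ∂μ =
      ∫ x in D t, g x ∂μ + ∑ s ∈ F, ∫ x in upperUnion le D s, g x ∂μ := by
  have hm : ∀ s, MeasurableSet (upperUnion le D s) := fun s => MeasurableSet.iUnion fun u => hDm u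
  rw [h.upperUnion_eq hF, setIntegral_union _ (Finset.measurableSet_biUnion _ fun s _ => hm s)
    hg.integrableOn hg.integrableOn, integral_biUnion_finset _ (fun s _ => hm s) _
    fun s _ => hg.integrableOn]
  · intro s hs r hr hsr
    exact h.disjoint_upperUnion hD
      (((hF s).1 hs).2.trans ((hF r).1 hr).2.symm) hsr
  · simp only [disjoint_iUnion_right]
    intro s hs
    exact h.disjoint_upperUnion_of_lt hD (by have := ((hF s).1 hs).2; omega)

end IsTreeOrder

theorem enorm_setIntegral_upperUnion_le [MeasurableSpace X] {μ : Measure X} [Countable Γ]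
    (hDm : ∀ t, MeasurableSet (D t)) (hD : Pairwise (Function.onFun Disjoint D)) (t : Γ)
    (g : X → ℝ) :
    ‖∫ x in upperUnion le D t, g x ∂μ‖ₑ ≤
      ∑' s, {s | le t s}.indicator (fun s => ∫⁻ x in D s, ‖g x‖ₑ ∂μ) s := by
  refine (enorm_integral_le_lintegral_enorm _).trans ?_
  rw [← tsum_subtype, upperUnion,
    lintegral_iUnion (s := fun s : {s | le t s} => D s) (fun s => hDm s)]
  exact fun i j hij => hD fun he => hij (Subtype.ext he)

theorem tsum_indicator_one_le_one {E : Γ → Set X} (hE : Pairwise (Function.onFun Disjoint E))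
    (x : X) : ∑' t, (E t).indicator (fun _ => (1 : ℝ≥0∞)) x ≤ 1 := by
  by_cases hx : ∃ t, x ∈ E t
  · obtain ⟨t, ht⟩ := hx
    rw [tsum_eq_single t, indicator_of_mem ht]
    intro s hst
    exact indicator_of_notMem (fun hs => disjoint_left.1 (hE hst) hs ht) _
  · push Not at hx
    simp [hx]

end Shadows

/-! ### Existence and uniqueness of parents. -/

section Parents

variable {Γ : Type u} {G : SimpleGraph Γ} {a : Γ}

theorem exists_isParent (hG : G.IsTree) {t : Γ} (ht : t ≠ a) : ∃ r, IsParent G a r t := by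
  have h0 : 0 < G.dist t a := hG.1.pos_dist_of_ne ht
  obtain ⟨r, -, hr, hd⟩ := (isTreeOrder_treeLE hG a).exists_between (G.dist t a - 1)
    (treeLE_root hG t) (by simp)
  simp only [SimpleGraph.dist_self, zero_add] at hd
  exact ⟨r, (isParent_iff hG).2 ⟨hr, by omega⟩⟩

theorem ne_root_of_isParent (hG : G.IsTree) {r t : Γ} (h : IsParent G a r t) : t ≠ a := by
  rintro rfl
  have := ((isParent_iff hG).1 h).2
  rw [SimpleGraph.dist_self] at this
  omega

theorem isParent_unique (hG : G.IsTree) {r s t : Γ} (hr : IsParent G a r t)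
    (hs : IsParent G a s t) : r = s := by
  rw [isParent_iff hG] at hr hs
  exact (isTreeOrder_treeLE hG a).inj hr.1 hs.1 (by omega)

end Parents

namespace IsJohnTreeCovering

variable {n : ℕ} {Ω : Set (EuclideanSpace ℝ (Fin n))} {Γ : Type u} {Q : Γ → DyadicCube n}
  {G : SimpleGraph Γ} {a : Γ} {K : ℝ}

theorem expanded_subset (h : IsJohnTreeCovering Ω Q G a K) (t : Γ) : expanded Q t ⊆ Ω := by
  rw [← h.treeCovering.iUnion_eq]; exact subset_iUnion (expanded Q) t

/-- Inner regularity gives a compact part of `B t` with more than half of its volume. Compactness is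
what keeps the closed support of the transfer inside the open sets `U_t` and `U_{t_p}`. -/
theorem exists_compact_pieces (h : IsJohnTreeCovering Ω Q G a K) :
    ∃ (E : Γ → Set (EuclideanSpace ℝ (Fin n))) (C : ℝ≥0), E a = ∅ ∧ (∀ t, IsCompact (E t)) ∧
      Pairwise (Function.onFun Disjoint E) ∧ (∀ t, E t ⊆ expanded Q t) ∧
      (∀ t r, IsParent G a r t → E t ⊆ expanded Q r) ∧
      (∀ t, t ≠ a → volume (E t) ≠ 0 ∧ volume ((Q t).openDilate 1) ≤ C * volume (E t)) := by
  classical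
  obtain ⟨B, C₂, hBo, hBd, hBU, hBv⟩ := h.treeCovering.exists_pieces
  have hG := h.treeCovering.isTree
  have key : ∀ t, ∃ E : Set (EuclideanSpace ℝ (Fin n)), IsCompact E ∧ (t = a → E = ∅) ∧
      (t ≠ a → E ⊆ B t ∧ volume (E) ≠ 0 ∧
        volume ((Q t).openDilate 1) ≤ (C₂ * 2 : ℝ≥0) * volume E) := by
    intro t
    rcases eq_or_ne t a with rfl | hta
    · exact ⟨∅, isCompact_empty, fun _ => rfl, fun hne => absurd rfl hne⟩
    have hDU : volume ((Q t).openDilate 1) ≤ C₂ * volume (B t) :=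
      (measure_mono ((Q t).openDilate_subset_openDilate (by norm_num))).trans (hBv t hta)
    have hB0 : volume (B t) ≠ 0 := by
      intro h0
      rw [h0, mul_zero, nonpos_iff_eq_zero] at hDU
      exact (Q t).volume_openDilate_ne_zero one_pos hDU
    have hBt : volume (B t) ≠ ∞ := by
      obtain ⟨r, hr⟩ := exists_isParent hG hta
      refine ne_top_of_le_ne_top ?_ (measure_mono ((hBU t r hta hr).trans inter_subset_left))
      rw [expanded, DyadicCube.volume_openDilate]
      finiteness
    obtain ⟨E, hEB, hEc, hE⟩ := (hBo t hta).exists_lt_isCompact (ENNReal.half_lt_self hB0 hBt)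
    refine ⟨E, hEc, fun he => absurd he hta, fun _ => ⟨hEB, (zero_le.trans_lt hE).ne', ?_⟩⟩
    calc volume ((Q t).openDilate 1) ≤ C₂ * volume (B t) := hDU
      _ = C₂ * 2 * (volume (B t) / 2) := by
          rw [mul_assoc, ENNReal.mul_div_cancel (by simp) (by simp)]
      _ ≤ C₂ * 2 * volume E := by gcongr
      _ = _ := by norm_cast
  choose E hEc hEa hE using key
  have hEB : ∀ t r, IsParent G a r t → E t ⊆ expanded Q t ∩ expanded Q r := fun t r hr =>
    ((hE t (ne_root_of_isParent hG hr)).1).trans (hBU t r (ne_root_of_isParent hG hr) hr)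
  refine ⟨E, C₂ * 2, hEa a rfl, hEc, ?_, ?_, fun t r hr => (hEB t r hr).trans inter_subset_right,
    fun t ht => (hE t ht).2⟩
  · intro s t hst
    rcases eq_or_ne s a with rfl | hs
    · rw [Function.onFun, hEa s rfl]; exact empty_disjoint _
    rcases eq_or_ne t a with rfl | ht
    · rw [Function.onFun, hEa t rfl]; exact disjoint_empty _
    exact (hBd s t hs ht hst).mono (hE s hs).1 (hE t ht).1
  · intro t
    rcases eq_or_ne t a with rfl | ht
    · rw [hEa t rfl]; exact empty_subset _
    · obtain ⟨r, hr⟩ := exists_isParent hG ht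
      exact (hEB t r hr).trans inter_subset_left

end IsJohnTreeCovering

section Decomposition

variable {n : ℕ} {Ω : Set (EuclideanSpace ℝ (Fin n))} {Γ : Type u} {Q : Γ → DyadicCube n}
  {G : SimpleGraph Γ} {a : Γ} {K : ℝ}

/-- The function on `E t` that carries the integral of `g` over the cubes above `t`. -/
noncomputable def transfer (G : SimpleGraph Γ) (a : Γ) (Q : Γ → DyadicCube n)
    (E : Γ → Set (EuclideanSpace ℝ (Fin n))) (g : EuclideanSpace ℝ (Fin n) → ℝ) (t : Γ) :
    EuclideanSpace ℝ (Fin n) → ℝ :=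
  (E t).indicator fun _ =>
    (∫ x in upperUnion (TreeLE G a) (fun t => (Q t).openDilate 1) t, g x) / volume.real (E t)

/-- The local part of `g` at `t`: the integral over the cubes above `t` is sent to the parent, and
the integrals over the cubes above the children are received. -/
noncomputable def treePart (G : SimpleGraph Γ) (a : Γ) (Q : Γ → DyadicCube n)
    (E : Γ → Set (EuclideanSpace ℝ (Fin n))) (F : Γ → Finset Γ)
    (g : EuclideanSpace ℝ (Fin n) → ℝ) (t : Γ) (x : EuclideanSpace ℝ (Fin n)) : ℝ :=
  ((Q t).openDilate 1).indicator g x - transfer G a Q E g t x + ∑ s ∈ F t, transfer G a Q E g s x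

theorem enorm_treePart_le (E : Γ → Set (EuclideanSpace ℝ (Fin n))) (F : Γ → Finset Γ)
    (g : EuclideanSpace ℝ (Fin n) → ℝ) (t : Γ) (x : EuclideanSpace ℝ (Fin n)) :
    ‖treePart G a Q E F g t x‖ₑ ≤ ‖g x‖ₑ + 2 * ∑' s, ‖transfer G a Q E g s x‖ₑ := by
  have h1 : ‖((Q t).openDilate 1).indicator g x‖ₑ ≤ ‖g x‖ₑ := enorm_indicator_le_enorm_self _ _
  calc ‖treePart G a Q E F g t x‖ₑ ≤ ‖((Q t).openDilate 1).indicator g x‖ₑ +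
        ‖transfer G a Q E g t x‖ₑ + ∑ s ∈ F t, ‖transfer G a Q E g s x‖ₑ := by
        refine (enorm_add_le _ _).trans ?_
        gcongr
        · exact enorm_sub_le
        · exact enorm_sum_le _ _
    _ ≤ ‖g x‖ₑ + ∑' s, ‖transfer G a Q E g s x‖ₑ + ∑' s, ‖transfer G a Q E g s x‖ₑ := by
        gcongr
        · exact ENNReal.le_tsum t
        · exact ENNReal.sum_le_tsum _
    _ = _ := by ring

/-- Each transfer is subtracted at its vertex and added at the parent, so it cancels in the sum; the
recursion `hIrec` for the integrals over `S t` makes every piece have mean zero. -/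
theorem isDecomposition_treePart (h : IsJohnTreeCovering Ω Q G a K)
    {E : Γ → Set (EuclideanSpace ℝ (Fin n))} (hEa : E a = ∅) (hEc : ∀ t, IsCompact (E t))
    (hEd : Pairwise (Function.onFun Disjoint E)) (hEU : ∀ t, E t ⊆ expanded Q t)
    (hEp : ∀ t r, IsParent G a r t → E t ⊆ expanded Q r)
    (hE0 : ∀ t, t ≠ a → volume (E t) ≠ 0) {F : Γ → Finset Γ}
    (hF : ∀ t s, s ∈ F t ↔ IsParent G a t s) {g : EuclideanSpace ℝ (Fin n) → ℝ}
    (hg : IntegrableOn g Ω) (hg0 : ∫ x in Ω, g x = 0) :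
    IsDecomposition Ω (expanded Q) g (treePart G a Q E F g) := by
  have hG := h.treeCovering.isTree
  have hord := isTreeOrder_treeLE hG a
  have := h.whitney.countable
  set D : Γ → Set (EuclideanSpace ℝ (Fin n)) := fun t => (Q t).openDilate 1 with hD
  have hDm : ∀ t, MeasurableSet (D t) := fun t => ((Q t).isOpen_openDilate 1).measurableSet
  have hDd : Pairwise (Function.onFun Disjoint D) := h.whitney.pairwise_disjoint_openDilate
  have hDU : ∀ t, D t ⊆ expanded Q t := fun t =>
    (Q t).openDilate_subset_openDilate (by norm_num)
  have hDΩ : ∀ t, D t ⊆ Ω := fun t => (hDU t).trans (h.expanded_subset t)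
  set I : Γ → ℝ := fun t => ∫ x in upperUnion (TreeLE G a) D t, g x with hI
  have hSΩ : ∀ t, upperUnion (TreeLE G a) D t ⊆ Ω := fun t => iUnion_subset fun s => hDΩ s
  have hIrec : ∀ t, I t = (∫ x in D t, g x) + ∑ s ∈ F t, I s := by
    intro t
    have h1 := hord.setIntegral_upperUnion (μ := volume.restrict Ω) hDm hDd (t := t) (F := F t)
      (fun s => by rw [hF, isParent_iff hG]) hg
    have h2 : ∀ A ⊆ Ω, MeasurableSet A →
        ∫ x in A, g x ∂(volume.restrict Ω) = ∫ x in A, g x := fun A hA hAm => by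
      rw [Measure.restrict_restrict hAm, inter_eq_left.2 hA]
    rw [h2 _ (hSΩ t) (MeasurableSet.iUnion fun u => hDm u), h2 _ (hDΩ t) (hDm t)] at h1
    rw [hI]
    simp only
    rw [h1]
    congr 1
    exact Finset.sum_congr rfl fun s _ => h2 _ (hSΩ s) (MeasurableSet.iUnion fun u => hDm u)
  have hIa : I a = 0 := by
    rw [← hg0, hI]
    refine setIntegral_congr_set ?_
    filter_upwards [h.whitney.ae_mem_iUnion_openDilate] with x hx
    refine propext ⟨fun hxS => hSΩ a hxS, fun hxΩ => ?_⟩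
    obtain ⟨t, ht⟩ := mem_iUnion.1 (hx hxΩ)
    exact mem_upperUnion.2 ⟨t, treeLE_root hG t, ht⟩
  have hTi : ∀ t, Integrable (transfer G a Q E g t) := fun t =>
    (integrable_indicator_iff (hEc t).measurableSet).2
      (integrableOn_const (hEc t).measure_lt_top.ne)
  have hTint : ∀ t s, E s ⊆ expanded Q t → ∫ x in expanded Q t, transfer G a Q E g s x = I s := by
    intro t s hst
    rw [transfer, setIntegral_indicator (hEc s).measurableSet, inter_eq_right.2 hst,
      setIntegral_const, smul_eq_mul]
    -- At the root `E a` is empty and nothing is transferred, which is correct only because `I a =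
    -- 0`.
    rcases eq_or_ne s a with rfl | hs
    · change _ * (I s / _) = I s
      rw [hIa, zero_div, mul_zero]
    · refine mul_div_cancel₀ _ ?_
      rw [measureReal_def]
      exact (ENNReal.toReal_pos (hE0 s hs) (hEc s).measure_lt_top.ne).ne'
  refine ⟨fun t => ?_, ?_, fun t => ?_, fun t => ?_⟩
  · exact ((hg.indicator (hDm t)).sub (hTi t).integrableOn).add
      (integrable_finsetSum _ fun s _ => (hTi s).integrableOn)
  · have hae : ∀ᵐ x ∂(volume.restrict Ω), x ∈ ⋃ t, D t := by
      have h1 := h.whitney.ae_mem_iUnion_openDilate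
      have h2 : MeasurableSet (⋃ t, D t) := MeasurableSet.iUnion hDm
      rw [ae_restrict_iff (p := fun x => x ∈ ⋃ t, D t) h2]
      exact h1
    filter_upwards [hae] with x hx
    obtain ⟨t₀, ht₀⟩ := mem_iUnion.1 hx
    have hs1 : HasSum (fun t => (D t).indicator g x) (g x) := by
      have := hasSum_single (f := fun t => (D t).indicator g x) t₀ fun t ht =>
        indicator_of_notMem (fun hxt => disjoint_left.1 (hDd ht) hxt ht₀) _
      simpa only [indicator_of_mem ht₀] using this
    -- The `E s` are disjoint, so at most one transfer is nonzero at `x`; it enters with a minus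
    -- sign at `s` and a plus sign at the parent of `s`.
    by_cases hxE : ∃ s, x ∈ E s
    · obtain ⟨s, hs⟩ := hxE
      have hsa : s ≠ a := by
        rintro rfl
        rw [hEa] at hs
        exact hs
      obtain ⟨r, hr⟩ := exists_isParent hG hsa
      have hzero : ∀ t, t ≠ s → transfer G a Q E g t x = 0 := fun t ht =>
        indicator_of_notMem (fun hxt => disjoint_left.1 (hEd ht) hxt hs) _
      have hs2 : HasSum (fun t => transfer G a Q E g t x) (transfer G a Q E g s x) :=
        hasSum_single s hzero
      have hs3 : HasSum (fun t => ∑ s ∈ F t, transfer G a Q E g s x)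
          (transfer G a Q E g s x) := by
        have h1 : ∑ u ∈ F r, transfer G a Q E g u x = transfer G a Q E g s x :=
          Finset.sum_eq_single s (fun u _ hu => hzero u hu)
            fun hsr => absurd ((hF r s).2 hr) hsr
        rw [← h1]
        refine hasSum_single r fun t ht => Finset.sum_eq_zero fun u hu => hzero u ?_
        rintro rfl
        exact ht (isParent_unique hG ((hF t u).1 hu) hr)
      simpa [treePart] using (hs1.sub hs2).add hs3
    · push Not at hxE
      have hzero : ∀ t, transfer G a Q E g t x = 0 := fun t => indicator_of_notMem (hxE t) _
      simpa [treePart, hzero] using hs1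
  -- The closed cube, rather than its interior, together with finitely many compact pieces is a
  -- closed set inside the open `U_t`.
  · refine (closure_minimal (t := (Q t).carrier ∪ (E t ∪ ⋃ s ∈ F t, E s)) ?_ ?_).trans ?_
    · intro x hx
      by_contra hxn
      simp only [mem_union, mem_iUnion, not_or, not_exists] at hxn
      obtain ⟨h1, h2, h3⟩ := hxn
      refine hx ?_
      have h4 : x ∉ (Q t).openDilate 1 := fun h' => h1 ((Q t).openDilate_one_subset_carrier h')
      rw [treePart, indicator_of_notMem h4, transfer, indicator_of_notMem h2,
        Finset.sum_eq_zero fun s hs => show transfer G a Q E g s x = 0 from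
          indicator_of_notMem (h3 s hs) _]
      simp
    · exact (Q t).isClosed_carrier.union ((hEc t).isClosed.union
        (isClosed_biUnion_finset fun s _ => (hEc s).isClosed))
    · refine union_subset ((Q t).carrier_subset_openDilate (by norm_num))
        (union_subset (hEU t) (iUnion₂_subset fun s hs => hEp s t ((hF t s).1 hs)))
  · have hgU : IntegrableOn g (expanded Q t) := hg.mono_set (h.expanded_subset t)
    simp only [treePart]
    rw [integral_add (f := fun x => (D t).indicator g x - transfer G a Q E g t x)
      (g := fun x => ∑ s ∈ F t, transfer G a Q E g s x) ((hgU.indicator (hDm t)).sub (hTi t).integrableOn)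
      (integrable_finsetSum _ fun s _ => (hTi s).integrableOn),
      integral_sub (hgU.indicator (hDm t)) (hTi t).integrableOn,
      integral_finsetSum _ fun s _ => (hTi s).integrableOn, hTint t t (hEU t),
      setIntegral_indicator (hDm t), inter_eq_right.2 (hDU t), hIrec t,
      Finset.sum_congr rfl fun s hs => hTint t s (hEp s t ((hF t s).1 hs))]
    ring

end Decomposition

/-! ### The norm estimate -/

theorem lintegral_add_mul_rpow_le {X : Type*} [MeasurableSpace X] {μ : Measure X} {q : X → ℝ}
    {P : ℝ} (hP : 0 ≤ P) (hq : AEMeasurable q μ) (hq1 : ∀ᵐ x ∂μ, 1 ≤ q x)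
    (hqP : ∀ᵐ x ∂μ, q x ≤ P) {f T : X → ℝ≥0∞} (hf : AEMeasurable f μ) {k : ℝ≥0∞} (hk : 1 ≤ k)
    (hkt : k ≠ ∞) :
    ∫⁻ x, (f x + k * T x) ^ q x ∂μ ≤
      2 ^ P * (∫⁻ x, f x ^ q x ∂μ + k ^ P * ∫⁻ x, T x ^ q x ∂μ) := by
  have h2 : (2 : ℝ≥0∞) ^ P ≠ ∞ := ENNReal.rpow_ne_top_of_nonneg hP (by simp)
  have hk' : k ^ P ≠ ∞ := ENNReal.rpow_ne_top_of_nonneg hP hkt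
  rw [← lintegral_const_mul' _ _ hk', ← lintegral_add_left' (hf.pow hq),
    ← lintegral_const_mul' _ _ h2]
  refine lintegral_mono_ae ?_
  filter_upwards [hq1, hqP] with x h1 hP'
  calc (f x + k * T x) ^ q x ≤ 2 ^ (q x - 1) * (f x ^ q x + (k * T x) ^ q x) :=
        ENNReal.rpow_add_le_mul_rpow_add_rpow _ _ h1
    _ ≤ 2 ^ P * (f x ^ q x + k ^ P * T x ^ q x) := by
        rw [ENNReal.mul_rpow_of_nonneg _ _ (by linarith)]
        gcongr ?_ * (_ + ?_ * _)
        · exact ENNReal.rpow_le_rpow_of_exponent_le (by norm_num) (by linarith)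
        · exact ENNReal.rpow_le_rpow_of_exponent_le hk hP'

section Main

variable {n : ℕ} {Ω : Set (EuclideanSpace ℝ (Fin n))} {q : EuclideanSpace ℝ (Fin n) → ℝ≥0∞}

theorem MemVarLp.integrableOn (hΩ : MeasurableSet Ω) (hΩt : volume Ω ≠ ∞)
    (hfin : ∀ᵐ x ∂(volume.restrict Ω), q x ≠ ∞)
    (hq1 : ∀ᵐ x ∂(volume.restrict Ω), 1 ≤ (q x).toReal)
    {g : EuclideanSpace ℝ (Fin n) → ℝ} (hg : MemVarLp Ω q g) : IntegrableOn g Ω := by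
  obtain ⟨hgm, c, hc, hm⟩ := hg
  rw [modular_eq_lintegral hΩ hfin] at hm
  refine ⟨hgm.aestronglyMeasurable, ?_⟩
  have hc0 : ENNReal.ofReal c ≠ 0 := by simpa using hc
  calc ∫⁻ x in Ω, ‖g x‖ₑ
      ≤ ∫⁻ x in Ω, ENNReal.ofReal c * (1 + (‖g x‖ₑ / ENNReal.ofReal c) ^ (q x).toReal) := by
        refine lintegral_mono_ae ?_
        filter_upwards [hq1] with x hx
        have h1 := le_one_add_rpow_rpow (x := ‖g x‖ₑ / ENNReal.ofReal c) one_pos hx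
        rw [div_one, ENNReal.rpow_one, ENNReal.div_le_iff hc0 ENNReal.ofReal_ne_top] at h1
        rwa [mul_comm]
    _ = ENNReal.ofReal c * (volume Ω +
          ∫⁻ x in Ω, (‖g x‖ₑ / ENNReal.ofReal c) ^ (q x).toReal) := by
        rw [lintegral_const_mul' _ _ ENNReal.ofReal_ne_top, lintegral_add_left measurable_const]
        simp
    _ < ∞ := by
        have := hm.ne
        have h2 : volume Ω ≠ ∞ := hΩt
        finiteness

variable {Γ : Type u} {Q : Γ → DyadicCube n} {G : SimpleGraph Γ} {a : Γ} {K : ℝ}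

/-- Replaces the normalization `|E t|⁻¹` by `|D t|⁻¹` and `∫_{S t} g` by the sum of local integrals,
giving the form handled by the Hardy inequality. -/
theorem enorm_transfer_le (h : IsJohnTreeCovering Ω Q G a K)
    {E : Γ → Set (EuclideanSpace ℝ (Fin n))} (hEa : E a = ∅) (hEt : ∀ t, volume (E t) ≠ ∞)
    {C : ℝ≥0}
    (hE : ∀ t, t ≠ a → volume (E t) ≠ 0 ∧ volume ((Q t).openDilate 1) ≤ C * volume (E t))
    (g : EuclideanSpace ℝ (Fin n) → ℝ) {c : ℝ≥0∞} (hc : c ≠ ∞)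
    {f : EuclideanSpace ℝ (Fin n) → ℝ≥0∞} (hgf : ∀ x, ‖g x‖ₑ ≤ c * f x)
    (t : Γ) (x : EuclideanSpace ℝ (Fin n)) :
    ‖transfer G a Q E g t x‖ₑ ≤ c * (C * (E t).indicator (fun _ =>
      (volume ((Q t).openDilate 1))⁻¹ * ∑' s, {s | TreeLE G a t s}.indicator
        (fun s => ∫⁻ y in (Q s).openDilate 1, f y) s) x) := by
  have := h.whitney.countable
  by_cases hx : x ∈ E t
  swap
  · rw [transfer, indicator_of_notMem hx, enorm_zero]; exact zero_le
  have hta : t ≠ a := by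
    rintro rfl
    rw [hEa] at hx
    exact hx
  obtain ⟨h0, hDE⟩ := hE t hta
  have hD0 := (Q t).volume_openDilate_ne_zero one_pos
  have hDt : volume ((Q t).openDilate 1) ≠ ∞ := by
    rw [DyadicCube.volume_openDilate]; finiteness
  rw [transfer, indicator_of_mem hx, indicator_of_mem hx, div_eq_mul_inv, enorm_mul,
    enorm_inv (by rw [measureReal_def]; exact (ENNReal.toReal_pos h0 (hEt t)).ne'),
    measureReal_def, Real.enorm_of_nonneg ENNReal.toReal_nonneg, ENNReal.ofReal_toReal (hEt t)]
  have h1 : (volume (E t))⁻¹ ≤ C * (volume ((Q t).openDilate 1))⁻¹ := by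
    rw [← div_eq_mul_inv, ENNReal.le_div_iff_mul_le (Or.inl hD0) (Or.inl hDt), mul_comm,
      ← div_eq_mul_inv, ENNReal.div_le_iff h0 (hEt t)]
    exact hDE
  have h2 : ‖∫ x in upperUnion (TreeLE G a) (fun t => (Q t).openDilate 1) t, g x‖ₑ ≤
      c * ∑' s, {s | TreeLE G a t s}.indicator (fun s => ∫⁻ y in (Q s).openDilate 1, f y) s := by
    refine (enorm_setIntegral_upperUnion_le
      (fun s => ((Q s).isOpen_openDilate 1).measurableSet)
      h.whitney.pairwise_disjoint_openDilate t g).trans ?_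
    rw [← ENNReal.tsum_mul_left]
    refine ENNReal.tsum_le_tsum fun s => ?_
    by_cases hs : s ∈ {s | TreeLE G a t s}
    · rw [indicator_of_mem hs, indicator_of_mem hs, ← lintegral_const_mul' _ _ hc]
      exact lintegral_mono hgf
    · rw [indicator_of_notMem hs]; exact zero_le
  calc _ ≤ (c * ∑' s, {s | TreeLE G a t s}.indicator
        (fun s => ∫⁻ y in (Q s).openDilate 1, f y) s) *
        (C * (volume ((Q t).openDilate 1))⁻¹) := by gcongr
    _ = _ := by ring

/-- The estimate is homogeneous, so it is enough to treat `f₀ = |g| / c` with modular at most one.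
Then `f₀ + k T` has bounded modular and dominates every `g_t` up to the factor `c`, and only the
averaging estimate for a single function remains. -/
theorem exists_decomposition (hn : 1 ≤ n) (hK : 1 < K) {τ : ℝ} (hΩ : IsBoundedDomain Ω)
    (h : IsJohnTreeCovering Ω Q G a K) (hτ : IsShadowConstant Ω Q G a τ) (hq : IsExponent Ω q)
    (hLH : BoundaryLogHolder Ω τ q) (hq1 : 1 < expMinus q Ω) (hqt : expPlus q Ω < ∞) :
    ∃ C : ℝ≥0, ∀ g : EuclideanSpace ℝ (Fin n) → ℝ, MemVarLp Ω q g → ∫ x in Ω, g x = 0 →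
      ∃ gt : Γ → EuclideanSpace ℝ (Fin n) → ℝ, IsDecomposition Ω (expanded Q) g gt ∧
        luxNorm Ω q (localNormSum Ω (expanded Q) q gt) ≤ C * luxNorm Ω q (fun x => ‖g x‖ₑ) := by
  obtain ⟨hΩo, hΩc, hΩb⟩ := hΩ
  have hΩm := hΩo.measurableSet
  have hΩt : volume Ω ≠ ∞ := hΩb.measure_lt_top.ne
  have hΩ0 : volume Ω ≠ 0 := hΩo.measure_ne_zero volume hΩc.nonempty
  have hcount := h.whitney.countable
  have hG := h.treeCovering.isTree
  set μ := volume.restrict Ω with hμ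
  have hμf : IsFiniteMeasure μ := ⟨by rw [hμ, Measure.restrict_apply_univ]; exact hΩt.lt_top⟩
  set q' : EuclideanSpace ℝ (Fin n) → ℝ := fun x => (q x).toReal with hq'
  have hqm : AEMeasurable q' μ := hq.1.ennreal_toReal
  obtain ⟨p, P, r, R, L, hp, hpr, hrR, hRP, hqae, hqball, hL⟩ :=
    exists_exponent_bounds hn hΩo h.whitney hτ.1 hLH hq1 hqt hΩ0
  have hP0 : 0 ≤ P := by linarith [hpr a, hrR a, hRP a]
  have hfin : ∀ᵐ x ∂μ, q x ≠ ∞ := hqae.mono fun x hx => hx.1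
  have hq1' : ∀ᵐ x ∂μ, 1 ≤ q' x := hqae.mono fun x hx => hp.le.trans hx.2.1
  have hqP : ∀ᵐ x ∂μ, q' x ≤ P := hqae.mono fun x hx => hx.2.2
  set D : Γ → Set (EuclideanSpace ℝ (Fin n)) := fun t => (Q t).openDilate 1 with hD
  have hDm : ∀ t, MeasurableSet (D t) := fun t => ((Q t).isOpen_openDilate 1).measurableSet
  have hDd : Pairwise (Function.onFun Disjoint D) := h.whitney.pairwise_disjoint_openDilate
  have hDU : ∀ t, D t ⊆ expanded Q t := fun t => (Q t).openDilate_subset_openDilate (by norm_num)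
  have hUm : ∀ t, MeasurableSet (expanded Q t) := fun t => (h.treeCovering.isOpen t).measurableSet
  have hμeq : ∀ t, ∀ A ⊆ expanded Q t, μ A = volume A := fun t A hA =>
    Measure.restrict_eq_self _ (hA.trans (h.expanded_subset t))
  have hD0 : ∀ t, μ (D t) ≠ 0 := fun t => by
    rw [hμeq t _ (hDU t)]; exact (Q t).volume_openDilate_ne_zero one_pos
  have hqU : ∀ t s, TreeLE G a t s → ∀ᵐ x ∂μ, x ∈ expanded Q s → r t ≤ q' x ∧ q' x ≤ R t := by
    intro t s hts
    filter_upwards [hqball t] with x hx hxs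
    exact hx (hτ.2 t (mem_iUnion₂.2 ⟨s, hts, hxs⟩))
  have hrefl : ∀ t, TreeLE G a t t := (isTreeOrder_treeLE hG a).refl
  obtain ⟨E, C₁, hEa, hEc, hEd, hEU, hEp, hE⟩ := h.exists_compact_pieces
  obtain ⟨C₀, hC₀, hover⟩ := h.treeCovering.overlap
  have hchild := h.finite_children hn
  -- One summand for the volume above a vertex, the other for `|E t| ≤ |U_t| = (17/16)ⁿ |D t|`.
  set C₂ : ℝ≥0 := K.toNNReal ^ n + (17 / 16 : ℝ).toNNReal ^ n with hC₂
  obtain ⟨C₃, hC₃⟩ := exists_tsum_setLIntegral_rpow_le (μ := μ) (isTreeOrder_treeLE hG a) hDm hDd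
    (fun t => (hEc t).measurableSet) hEd hqm hq1' hp hpr hrR hRP
    (fun t s hts => (hqU t s hts).mono fun x hx hxs => (hx (hDU s hxs)).1)
    (fun t => (hqU t t (hrefl t)).mono fun x hx hxt => hx (hEU t hxt)) hD0 (L := L) (C := C₂)
    (fun t => by rw [hμeq t _ (hDU t)]; exact hL t)
    (fun t => by
      simp only [fun t => hμeq t _ (hDU t)]
      refine (h.tsum_volume_le hK t).trans ?_
      gcongr
      exact le_self_add)
    (fun t => by
      rw [hμeq t _ (hDU t), hμeq t _ (hEU t)]
      calc volume (E t) ≤ volume (expanded Q t) := measure_mono (hEU t)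
        _ = ((17 / 16 : ℝ).toNNReal ^ n : ℝ≥0) * volume (D t) := by
            rw [expanded, hD]
            simp only [DyadicCube.volume_openDilate, one_mul]
            rw [ENNReal.ofReal_mul (by norm_num), mul_pow, ENNReal.coe_pow]
            rfl
        _ ≤ _ := by gcongr; exact le_add_self)
  obtain ⟨C₄, hC₄⟩ := exists_lintegral_local_average_rpow_le hΩm hΩt hq.1 hfin hq1' hUm
    (fun t h0 => hD0 t (measure_mono_null (hDU t) h0)) (fun t => hp.le.trans (hpr t)) hrR hRP hqP
    (fun t => hqU t t (hrefl t)) (L := L) (C := C₀)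
    (fun t => by
      refine le_trans ?_ (hL t)
      rw [hμeq t _ subset_rfl]
      exact ENNReal.rpow_le_rpow (ENNReal.inv_le_inv.2 (measure_mono (hDU t)))
        (sub_nonneg.2 (hrR t)))
    hC₀ (hover.mono fun x hx => hx.2)
  set k : ℝ≥0 := 1 + 2 * C₁ with hk
  have h2P : (2 : ℝ≥0∞) ^ P ≠ ∞ := ENNReal.rpow_ne_top_of_nonneg hP0 (by simp)
  have hkP : (k : ℝ≥0∞) ^ P ≠ ∞ := ENNReal.rpow_ne_top_of_nonneg hP0 ENNReal.coe_ne_top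
  have hBt : (2 : ℝ≥0∞) ^ P * (1 + k ^ P * C₃) ≠ ∞ := by finiteness
  set B : ℝ := ((2 : ℝ≥0∞) ^ P * (1 + k ^ P * C₃)).toReal with hB
  have hBeq : ENNReal.ofReal B = (2 : ℝ≥0∞) ^ P * (1 + k ^ P * C₃) := ENNReal.ofReal_toReal hBt
  have hB1 : 1 ≤ ENNReal.ofReal B := by
    rw [hBeq]
    refine one_le_mul ?_ le_self_add
    rw [← ENNReal.one_rpow P]
    exact ENNReal.rpow_le_rpow (by norm_num) hP0
  have hB0 : 0 < B := one_pos.trans_le (ENNReal.one_le_ofReal.1 hB1)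
  have hC₄1 : (1 : ℝ) ≤ 1 + C₄ := by simp
  refine ⟨(B * (1 + C₄)).toNNReal, fun g hg hg0 => ?_⟩
  refine ⟨treePart G a Q E (fun t => (hchild t).toFinset) g,
    isDecomposition_treePart h hEa hEc hEd hEU hEp (fun t ht => (hE t ht).1)
      (fun t s => by simp) (hg.integrableOn hΩm hΩt hfin hq1') hg0, ?_⟩
  set gt := treePart G a Q E (fun t => (hchild t).toFinset) g with hgt
  have hBC : 0 < B * (1 + C₄) := by positivity
  change _ ≤ ENNReal.ofReal (B * (1 + C₄)) * _
  rw [mul_comm, ← ENNReal.div_le_iff (by simpa using hBC) ENNReal.ofReal_ne_top]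
  -- Every admissible `c` is treated, so the infimum need not be attained.
  refine le_sInf ?_
  rintro _ ⟨c, hc, hm, rfl⟩
  rw [ENNReal.div_le_iff (by simpa using hBC) ENNReal.ofReal_ne_top]
  have hc0 : ENNReal.ofReal c ≠ 0 := by simpa using hc
  set f₀ : EuclideanSpace ℝ (Fin n) → ℝ≥0∞ := fun x => ‖g x‖ₑ / ENNReal.ofReal c with hf₀
  have hgf : ∀ x, ‖g x‖ₑ = ENNReal.ofReal c * f₀ x := fun x =>
    (ENNReal.mul_div_cancel hc0 ENNReal.ofReal_ne_top).symm
  have hf₀m : AEMeasurable f₀ μ := hg.1.enorm.div_const _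
  rw [modular_eq_lintegral hΩm hfin] at hm
  set A : Γ → ℝ≥0∞ := fun t => (μ (D t))⁻¹ *
    ∑' s, {s | TreeLE G a t s}.indicator (fun s => ∫⁻ y in D s, f₀ y ∂μ) s with hA
  set T : EuclideanSpace ℝ (Fin n) → ℝ≥0∞ := fun x => ∑' t, (E t).indicator (fun _ => A t) x
    with hT
  have hTint : ∫⁻ x, T x ^ q' x ∂μ ≤ C₃ := by
    refine le_trans ?_ (hC₃ f₀ hf₀m hm)
    calc ∫⁻ x, T x ^ q' x ∂μ
        ≤ ∫⁻ x, ∑' t, (E t).indicator (fun x => A t ^ q' x) x ∂μ := by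
          refine lintegral_mono_ae ?_
          filter_upwards [hq1', hqP] with x h1 h2
          have := tsum_indicator_rpow_le le_rfl (tsum_indicator_one_le_one hEd x) A h1 h2
          rw [ENNReal.one_rpow, one_mul] at this
          exact this
      _ = ∑' t, ∫⁻ x in E t, A t ^ q' x ∂μ := by
          rw [lintegral_tsum fun t => (aemeasurable_const.pow hqm).indicator (hEc t).measurableSet]
          simp only [lintegral_indicator (hEc _).measurableSet]
  -- `B` bounds the modular of `f₀ + k T`, so `f` has modular at most one, as the averaging estimate
  -- requires; `f` is independent of `t`.
  set f : EuclideanSpace ℝ (Fin n) → ℝ≥0∞ := fun x => (f₀ x + k * T x) / ENNReal.ofReal B with hf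
  have hTm : Measurable T :=
    Measurable.tsum fun t => measurable_const.indicator (hEc t).measurableSet
  have hfm : AEMeasurable f μ := (hf₀m.add (hTm.const_mul _).aemeasurable).div_const _
  have hfint : ∫⁻ x, f x ^ q' x ∂μ ≤ 1 := by
    refine (lintegral_div_rpow_le hq1' _ hB1).trans ?_
    rw [mul_comm, ← div_eq_mul_inv]
    refine ENNReal.div_le_of_le_mul ?_
    rw [one_mul, hBeq]
    refine (lintegral_add_mul_rpow_le hP0 hqm hq1' hqP hf₀m (by simp [hk]) ENNReal.coe_ne_top).trans
      ?_
    gcongr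
  have hgtf : ∀ t x, ‖gt t x‖ₑ ≤ ENNReal.ofReal (c * B) * f x := by
    intro t x
    have h1 : ∑' s, ‖transfer G a Q E g s x‖ₑ ≤ ENNReal.ofReal c * (C₁ * T x) := by
      rw [hT, ← ENNReal.tsum_mul_left, ← ENNReal.tsum_mul_left]
      refine ENNReal.tsum_le_tsum fun s => ?_
      refine (enorm_transfer_le h hEa (fun t => (hEc t).measure_lt_top.ne) hE g
        ENNReal.ofReal_ne_top (fun x => (hgf x).le) s x).trans (le_of_eq ?_)
      have h2 : ∀ u, ∫⁻ y in D u, f₀ y ∂μ = ∫⁻ y in D u, f₀ y := fun u => by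
        rw [hμ, Measure.restrict_restrict_of_subset ((hDU u).trans (h.expanded_subset u))]
      simp only [hA, h2, hμeq _ _ (hDU _)]
      rfl
    rw [ENNReal.ofReal_mul hc.le, mul_assoc, hf,
      ENNReal.mul_div_cancel (by simpa using hB0) ENNReal.ofReal_ne_top]
    calc ‖gt t x‖ₑ ≤ ‖g x‖ₑ + 2 * ∑' s, ‖transfer G a Q E g s x‖ₑ := enorm_treePart_le _ _ _ _ _
      _ ≤ ENNReal.ofReal c * f₀ x + 2 * (ENNReal.ofReal c * (C₁ * T x)) := by
          rw [hgf]; gcongr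
      _ = ENNReal.ofReal c * (f₀ x + 2 * C₁ * T x) := by ring
      _ ≤ ENNReal.ofReal c * (f₀ x + k * T x) := by
          gcongr
          rw [hk]
          push_cast
          exact le_add_self
  set avg : EuclideanSpace ℝ (Fin n) → ℝ≥0∞ := fun x => ∑' t, (expanded Q t).indicator
    (fun _ => luxNorm Ω q ((expanded Q t).indicator f) /
      luxNorm Ω q ((expanded Q t).indicator fun _ => 1)) x with havg
  have havgle : luxNorm Ω q avg ≤ ENNReal.ofReal (1 + C₄) := by
    refine luxNorm_le_ofReal (by positivity) ?_
    rw [modular_eq_lintegral hΩm hfin]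
    refine (lintegral_div_rpow_le hq1' _ (ENNReal.one_le_ofReal.2 hC₄1)).trans ?_
    rw [mul_comm, ← div_eq_mul_inv]
    refine ENNReal.div_le_of_le_mul ?_
    rw [one_mul]
    refine (hC₄ f hfm hfint).trans ?_
    rw [ENNReal.ofReal_add zero_le_one C₄.coe_nonneg, ENNReal.ofReal_coe_nnreal]
    exact le_add_self
  have hle : luxNorm Ω q (localNormSum Ω (expanded Q) q gt) ≤
      ENNReal.ofReal (c * B) * luxNorm Ω q avg := by
    refine luxNorm_le_mul (by positivity) fun x => ?_
    rw [localNormSum, havg, ← ENNReal.tsum_mul_left]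
    refine ENNReal.tsum_le_tsum fun t => ?_
    by_cases hx : x ∈ expanded Q t
    · rw [indicator_of_mem hx, indicator_of_mem hx, ← mul_div_assoc]
      gcongr
      refine luxNorm_le_mul (by positivity) fun y => ?_
      by_cases hy : y ∈ expanded Q t
      · rw [indicator_of_mem hy, indicator_of_mem hy]
        exact hgtf t y
      · rw [indicator_of_notMem hy, enorm_zero]; exact zero_le
    · rw [indicator_of_notMem hx]; exact zero_le
  calc _ ≤ ENNReal.ofReal (c * B) * ENNReal.ofReal (1 + C₄) := hle.trans (by gcongr)
    _ = _ := by
        rw [← ENNReal.ofReal_mul (by positivity), ← ENNReal.ofReal_mul (by positivity)]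
        congr 1
        ring

end Main

end JohnDecomposition

theorem mainTheorem8 (n : ℕ) (hn : 1 ≤ n) (K : ℝ) (hK : 1 < K) :
    (∃ τ : ℝ, ∀ (Ω : Set (EuclideanSpace ℝ (Fin n))) (Γ : Type u) (Q : Γ → DyadicCube n)
      (G : SimpleGraph Γ) (a : Γ),
      IsBoundedJohnDomain Ω → IsJohnTreeCovering Ω Q G a K → IsShadowConstant Ω Q G a τ) ∧
    (∀ (Ω : Set (EuclideanSpace ℝ (Fin n))) (Γ : Type u) (Q : Γ → DyadicCube n)
      (G : SimpleGraph Γ) (a : Γ) (τ : ℝ) (q : EuclideanSpace ℝ (Fin n) → ℝ≥0∞),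
      IsBoundedJohnDomain Ω → IsJohnTreeCovering Ω Q G a K → IsShadowConstant Ω Q G a τ →
      IsExponent Ω q → BoundaryLogHolder Ω τ q → 1 < expMinus q Ω → expPlus q Ω < ∞ →
      ∃ C : ℝ≥0, ∀ g : EuclideanSpace ℝ (Fin n) → ℝ,
        MemVarLp Ω q g → ∫ x in Ω, g x = 0 →
        ∃ gt : Γ → EuclideanSpace ℝ (Fin n) → ℝ,
          IsDecomposition Ω (expanded Q) g gt ∧
          luxNorm Ω q (localNormSum Ω (expanded Q) q gt) ≤ C * luxNorm Ω q (fun x => ‖g x‖ₑ)) :=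
  ⟨⟨2 * K * √n + 1, fun _ _ _ _ _ _ h => h.isShadowConstant hn hK⟩,
    fun _ _ _ _ _ _ _ hΩ h hτ hq hLH hq1 hqt => exists_decomposition hn hK hΩ.1 h hτ hq hLH hq1 hqt⟩
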